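/- Let $N\ge 1$ be a squarefree integer with exactly $r$ prime factors, let $\sigma(N)$ be the sum of the positive divisors of $N$, and let $$\Gamma_0(N)^+=\left\{ e^{-1/2}\begin{pmatrix} a&b\\ c&d\end{pmatrix}\in \mathrm{SL}(2,\mathbb R):\ ad-bc=e,\ a,b,c,d,e\in\mathbb Z,\ e>0,\ e\mid N,\ e\mid a,\ e\mid d,\ N\mid c\right\}.$$ A cusp form of weight $k\in\mathbb Z$ on $X_N=\Gamma_0(N)^+\backslash\mathbb H$ is a holomorphic function $f$ on the upper half-plane $\mathbb H$ such that $f\big(\tfrac{\alpha z+\beta}{\gamma z+\delta}\big)=(\gamma z+\delta)^k f(z)$ for all $\begin{pmatrix}\alpha&\beta\\ \gamma&\delta\end{pmatrix}\in\Gamma_0(N)^+$ and such that $f$ vanishes at the cusp $i\infty$ (the only cusp of $X_N$). Then the smallest even integer $k_N$ for which there exists a cusp form of weight $k_N$ on $X_N$ that vanishes only at the cusp $i\infty$ (that is, has no zero in $\mathbb H$) is $$k_N=\operatorname{lcm}\left(4,\ 2^{r-1}\frac{24}{(24,\sigma(N))}\right),$$ where $(24,\sigma(N))$ denotes the greatest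 common divisor. -/

import Mathlib

/-- `g` is of the form `e^{-1/2} (a b; c d)` with integers `a, b, c, d` such that `ad - bc = e`,
where `e` is a positive divisor of `N`, `e ∣ a`, `e ∣ d` and `N ∣ c`. -/
def IsMoonshineMatrix (N : ℕ) (g : Matrix.SpecialLinearGroup (Fin 2) ℝ) : Prop :=
  ∃ (e : ℕ) (a b c d : ℤ), 0 < e ∧ e ∣ N ∧ a * d - b * c = (e : ℤ) ∧
    (e : ℤ) ∣ a ∧ (e : ℤ) ∣ d ∧ (N : ℤ) ∣ c ∧
    (g : Matrix (Fin 2) (Fin 2) ℝ) = (Real.sqrt e)⁻¹ • !![(a : ℝ), (b : ℝ); (c : ℝ), (d : ℝ)]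

theorem IsMoonshineMatrix.one (N : ℕ) : IsMoonshineMatrix N 1 := by
  refine ⟨1, 1, 0, 0, 1, by simp, by simp, by simp, by simp, by simp, by simp, ?_⟩
  ext i j
  fin_cases i <;> fin_cases j <;> simp

theorem IsMoonshineMatrix.inv {N : ℕ} {g : Matrix.SpecialLinearGroup (Fin 2) ℝ}
    (hg : IsMoonshineMatrix N g) : IsMoonshineMatrix N g⁻¹ := by
  obtain ⟨e, a, b, c, d, he, heN, hdet, ha, hd, hc, h⟩ := hg
  refine ⟨e, d, -b, -c, a, he, heN, by linarith, hd, ha, (dvd_neg).2 hc, ?_⟩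
  rw [Matrix.SpecialLinearGroup.coe_inv, h]
  ext i j
  fin_cases i <;> fin_cases j <;> simp [Matrix.adjugate_fin_two]

theorem IsMoonshineMatrix.mul {N : ℕ} {g g' : Matrix.SpecialLinearGroup (Fin 2) ℝ}
    (hg : IsMoonshineMatrix N g) (hg' : IsMoonshineMatrix N g') :
    IsMoonshineMatrix N (g * g') := by
  obtain ⟨e, a, b, c, d, he, heN, hdet, ha, hd, hc, h⟩ := hg
  obtain ⟨e', a', b', c', d', he', heN', hdet', ha', hd', hc', h'⟩ := hg'
  obtain ⟨k, u, v, hk, huv, rfl, rfl⟩ := Nat.exists_coprime' (Nat.gcd_pos_of_pos_left e' he)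
  have hu : 0 < u := Nat.pos_of_mul_pos_right he
  have hv : 0 < v := Nat.pos_of_mul_pos_right he'
  have hL : u * v * k ∣ N := by
    have := Nat.lcm_dvd heN heN'
    rwa [Nat.lcm_mul_right, huv.lcm_eq_mul] at this
  obtain ⟨M, rfl⟩ := hL
  obtain ⟨a, rfl⟩ := ha
  obtain ⟨d, rfl⟩ := hd
  obtain ⟨c, rfl⟩ := hc
  obtain ⟨a', rfl⟩ := ha'
  obtain ⟨d', rfl⟩ := hd'
  obtain ⟨c', rfl⟩ := hc'
  push_cast at hdet hdet' h h' ⊢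
  have hkz : (k : ℤ) ≠ 0 := by exact_mod_cast hk.ne'
  refine ⟨u * v, u * v * (k * a * a' + b * c' * M), u * a * b' + v * b * d',
    u * v * k * M * (c * (v * k * a') + d * (u * k) * c') / k,
    u * v * (M * c * b' + k * d * d'), Nat.mul_pos hu hv, ⟨k * M, by ring⟩, ?_,
    ⟨_, by push_cast; rfl⟩, ⟨_, by push_cast; rfl⟩, ?_, ?_⟩
  all_goals
    have hq : (u * v * k * M * (c * (v * k * a') + d * (u * k) * c') / k : ℤ)
        = u * v * k * M * (c * v * a' + d * u * c') := by
      rw [show (u * v * k * M * (c * (v * k * a') + d * (u * k) * c') : ℤ)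
        = k * (u * v * k * M * (c * v * a' + d * u * c')) by ring]
      exact Int.mul_ediv_cancel_left _ hkz
    rw [hq]
  · apply mul_left_cancel₀ (mul_ne_zero hkz hkz)
    push_cast
    calc _ = (u * k * a * (u * k * d) - b * (u * v * k * M * c)) *
          (v * k * a' * (v * k * d') - b' * (u * v * k * M * c') : ℤ) := by ring
      _ = _ := by rw [hdet, hdet']; ring
  · exact ⟨c * v * a' + d * u * c', by push_cast; ring⟩
  · rw [Matrix.SpecialLinearGroup.coe_mul, h, h']
    have hk0 : (0 : ℝ) < k := by exact_mod_cast hk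
    have hs : (Real.sqrt (u * k))⁻¹ * (Real.sqrt (v * k))⁻¹ = (Real.sqrt (u * v))⁻¹ * (k : ℝ)⁻¹ := by
      rw [← mul_inv, ← mul_inv, ← Real.sqrt_mul (by positivity),
        show (u * k * (v * k) : ℝ) = (u * v) * k ^ 2 by ring, Real.sqrt_mul (by positivity),
        Real.sqrt_sq hk0.le]
    rw [Matrix.smul_mul, Matrix.mul_smul, smul_smul, hs, mul_smul]
    push_cast
    congr 1
    ext i j
    fin_cases i <;> fin_cases j <;> simp <;> field_simp

/-- The group `Γ₀(N)⁺`, as a subgroup of `SL(2, ℝ)`. -/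
def moonshineGroup (N : ℕ) : Subgroup (Matrix.SpecialLinearGroup (Fin 2) ℝ) where
  carrier := {g | IsMoonshineMatrix N g}
  one_mem' := IsMoonshineMatrix.one N
  mul_mem' := IsMoonshineMatrix.mul
  inv_mem' := IsMoonshineMatrix.inv

/-- The group `Γ₀(N)⁺`, viewed inside `GL(2, ℝ)`: the form in which Mathlib's modular forms take
their level. -/
def moonshineLevel (N : ℕ) : Subgroup (Matrix.GeneralLinearGroup (Fin 2) ℝ) :=
  (moonshineGroup N).map Matrix.SpecialLinearGroup.toGL

/-- There is a cusp form of weight `k` on `X_N = Γ₀(N)⁺ \ ℍ` which vanishes only at the cusp: it is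
zero at the cusp, being a cusp form, and has no zero in the upper half-plane. -/
def HasCuspFormVanishingOnlyAtCusp (N : ℕ) (k : ℤ) : Prop :=
  ∃ f : CuspForm (moonshineLevel N) k, ∀ z : UpperHalfPlane, f z ≠ 0

/-- The number `2^{r-1} · 24 / (24, σ(N))`, where `r` is the number of prime factors of `N`.
It is written as `(2^r · (24 / (24, σ(N)))) / 2` so that `r = 0` is allowed; both divisions are
exact for every squarefree `N`. -/
def cuspWeightFactor (N : ℕ) : ℕ :=
  2 ^ N.primeFactors.card * (24 / Nat.gcd 24 (ArithmeticFunction.sigma 1 N)) / 2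

/-! ### Divisor products, Jacobi symbols and exponent sums over divisors -/

section

open ArithmeticFunction

/-! Write `r` for the number of primes dividing `N` and `K` for the claimed minimum.

Existence. The form is the eta product `D = ∏_{v ∣ N} η(vτ)^l` with `2^r l = 2K`. It has weight `K`,
no zero in the upper half-plane, and order `s = l σ(N) / 24 > 0` at the cusp. What needs proof is
that its character is trivial. An Atkin–Lehner matrix with parameter `e` permutes the factors by `gh
↦ (e/g)h` for `g ∣ e` and `h ∣ N/e`, so the eta multipliers combine into a product of Jacobi
symbols, a power of the 24th root of unity, and a power of `√e` which the weight factor absorbs.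
Each is trivial once `4 ∣ K` and `24 ∣ l σ(N)` (`etaProd_slash_atkinLehner`). The eta multiplier is
needed only for odd positive lower left entry, because such matrices suffice to test invariance
(`slash_eq_self_of_mem_moonshineLevel`).

Minimality. Let `f` be a nowhere vanishing cusp form of even weight `k`; then `k > 0`. The forms
`f^K` and `D^k` have the same weight and no zeros, and there is only one cusp, so one of the two
quotients is bounded there and hence constant. On `q`-expansions this gives `f = q^n A` with `nK =
sk` and `A^K = c E^(lk)`, where `E = ∏_{v ∣ N} ∏ (1 - q^(vn))`; formally, `A` is a multiple of
`E^(2k/2^r)`. Three divisibilities finish the proof (`lcm_dvd_of_sigma_eq`): (1) `4 ∣ k`, from the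
fixed point of the Fricke involution (`four_dvd_of_ne_zero`); (2) `2^r ∣ 2k`
(`two_pow_dvd_of_pow_eq`); (3) with `x = 2k/2^r`, the order relation reads `24n = x σ(N)`, so
`24/(24, σ(N))` divides `x`.

Point (2) is the deep one. If it fails, a suitable power of `f` is, up to a constant and a power of
`q`, a square root of `E^t` with `t` odd. As `E = 1 - q + ...`, the 2-adic absolute values of the
coefficients of that root are those of `(1 + X)^(1/2)`, so they at least double at each step
(`exists_sq_eq_padicNorm_coeff`). But for a prime `p ∣ N` the operator `U_p` acts on forms for
`Γ₀(N)`, which are determined by finitely many coefficients; this forces a linear recurrence among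
`a(n), a(pn), a(p²n), ...` with coefficients independent of `n` (`exists_linear_recurrence`), which
such growth contradicts. -/

theorem Nat.Coprime.prod_divisors_mul_eq {α : Type*} [CommMonoid α] {e M : ℕ} (h : e.Coprime M)
    (F : ℕ → α) :
    ∏ v ∈ (e * M).divisors, F v = ∏ g ∈ e.divisors, ∏ h ∈ M.divisors, F (g * h) := by
  rw [← Finset.prod_product', Nat.divisors_mul, Finset.mul_def, Finset.prod_image]
  exact h.mul_injOn_divisors

theorem Squarefree.card_divisors_eq {n : ℕ} (hn : Squarefree n) :
    n.divisors.card = 2 ^ n.primeFactors.card := by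
  rw [Nat.card_divisors hn.ne_zero, ← Finset.prod_const]
  refine Finset.prod_congr rfl fun p hp => ?_
  rw [Nat.factorization_eq_one_of_squarefree hn (Nat.prime_of_mem_primeFactors hp)
    (Nat.dvd_of_mem_primeFactors hp)]

theorem Squarefree.two_pow_dvd_sigma {n : ℕ} (hn : Squarefree n) (ho : Odd n) :
    2 ^ n.primeFactors.card ∣ sigma 1 n := by
  rw [← IsMultiplicative.prod_primeFactors (isMultiplicative_sigma (k := 1)) hn,
    ← Finset.prod_const]
  refine Finset.prod_dvd_prod_of_dvd _ _ fun p hp => ?_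
  have hpp := Nat.prime_of_mem_primeFactors hp
  have : Odd p := ho.of_dvd_nat (Nat.dvd_of_mem_primeFactors hp)
  rw [sigma_one_apply, hpp.sum_divisors]
  exact (this.add_odd odd_one).two_dvd

theorem Nat.prod_divisors_sq_eq (n : ℕ) : (∏ d ∈ n.divisors, d) ^ 2 = n ^ n.divisors.card := by
  rw [sq]
  nth_rewrite 1 [← Nat.prod_div_divisors]
  rw [← Finset.prod_mul_distrib, ← Finset.prod_const]
  exact Finset.prod_congr rfl fun d hd => Nat.div_mul_cancel (Nat.dvd_of_mem_divisors hd)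

/-- The product of the divisors is `n` to half their number, and with two prime factors that number
is divisible by 4. -/
theorem Squarefree.exists_prod_divisors_mul_eq_sq {n : ℕ} (hn : Squarefree n)
    (h2 : 2 ≤ n.primeFactors.card) : ∃ m : ℕ, ∏ d ∈ n.divisors, d = m ^ 2 ∧
      ∃ j, n.divisors.card = 2 * j := by
  obtain ⟨j, hj⟩ : ∃ j, n.primeFactors.card = j + 2 := ⟨_, (Nat.sub_add_cancel h2).symm⟩
  have hc : n.divisors.card = 4 * 2 ^ j := by rw [hn.card_divisors_eq, hj]; ring
  refine ⟨n ^ 2 ^ j, ?_, 2 * 2 ^ j, by rw [hc]; ring⟩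
  have := n.prod_divisors_sq_eq
  rw [hc] at this
  apply Nat.pow_left_injective (n := 2) (by norm_num)
  simp only [this]
  ring

theorem jacobiSym_prod_left {ι : Type*} (s : Finset ι) (f : ι → ℤ) (n : ℕ) :
    jacobiSym (∏ i ∈ s, f i) n = ∏ i ∈ s, jacobiSym (f i) n := by
  classical
  induction s using Finset.induction_on with
  | empty => simp
  | insert a s ha ih => rw [Finset.prod_insert ha, Finset.prod_insert ha, jacobiSym.mul_left, ih]

theorem jacobiSym_prod_right {ι : Type*} (s : Finset ι) (a : ℤ) (f : ι → ℕ)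
    (hf : ∀ i ∈ s, f i ≠ 0) :
    jacobiSym a (∏ i ∈ s, f i) = ∏ i ∈ s, jacobiSym a (f i) := by
  classical
  induction s using Finset.induction_on with
  | empty => simp
  | insert i s hi ih =>
    have h1 := hf i (Finset.mem_insert_self _ _)
    have h2 : ∀ j ∈ s, f j ≠ 0 := fun j hj => hf j (Finset.mem_insert_of_mem hj)
    rw [Finset.prod_insert hi, Finset.prod_insert hi,
      jacobiSym.mul_right' _ h1 (Finset.prod_ne_zero_iff.2 h2), ih h2]

/-- If `eM` is squarefree with at least three prime factors, the product over `G ∣ e`, `H ∣ M` of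
the Jacobi symbols `(Gd / Hc)` is trivial. -/
theorem prod_prod_jacobiSym_eq_one {e M : ℕ} (hN : Squarefree (e * M))
    (h3 : 3 ≤ (e * M).primeFactors.card) {c : ℕ} {d : ℤ} (hc : c ≠ 0)
    (hcop : IsCoprime ((e : ℤ) * d) ((M : ℤ) * c)) :
    ∏ G ∈ e.divisors, ∏ H ∈ M.divisors, jacobiSym ((G : ℤ) * d) (H * c) = 1 := by
  obtain ⟨hcp, he, hM⟩ := Nat.squarefree_mul_iff.1 hN
  have hcopGH : ∀ G ∈ e.divisors, ∀ H ∈ M.divisors, IsCoprime ((G : ℤ) * d) ((H : ℤ) * c) := by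
    intro G hG H hH
    refine (hcop.of_isCoprime_of_dvd_left ?_).of_isCoprime_of_dvd_right ?_
    · exact mul_dvd_mul_right (Int.natCast_dvd_natCast.2 (Nat.dvd_of_mem_divisors hG)) _
    · exact mul_dvd_mul_right (Int.natCast_dvd_natCast.2 (Nat.dvd_of_mem_divisors hH)) _
  rw [Nat.Coprime.primeFactors_mul hcp, Finset.card_union_of_disjoint
    hcp.disjoint_primeFactors] at h3
  -- One of `e`, `M` has two prime factors. Taking the product over its divisors first turns the
  -- corresponding entry of the symbol into a square.
  rcases le_or_gt 2 e.primeFactors.card with h2 | h2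
  · obtain ⟨m, hm, j, hj⟩ := he.exists_prod_divisors_mul_eq_sq h2
    rw [Finset.prod_comm]
    refine Finset.prod_eq_one fun H hH => ?_
    rw [← jacobiSym_prod_left, Finset.prod_mul_distrib, Finset.prod_const, hj, ← Nat.cast_prod, hm]
    have : ((m ^ 2 : ℕ) : ℤ) * d ^ (2 * j) = (m * d ^ j) ^ 2 := by push_cast; ring
    rw [this]
    apply jacobiSym.sq_one'
    rw [← Int.isCoprime_iff_gcd_eq_one]
    have h4 : IsCoprime (∏ G ∈ e.divisors, ((G : ℤ) * d)) ((H : ℤ) * c) :=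
      IsCoprime.prod_left fun G hG => hcopGH G hG H hH
    rw [Finset.prod_mul_distrib, Finset.prod_const, hj, ← Nat.cast_prod, hm, this] at h4
    exact_mod_cast (IsCoprime.pow_left_iff two_pos).1 h4
  · obtain ⟨m, hm, j, hj⟩ := hM.exists_prod_divisors_mul_eq_sq (by omega)
    refine Finset.prod_eq_one fun G hG => ?_
    have h0 : ∀ H ∈ M.divisors, H * c ≠ 0 := fun H hH =>
      mul_ne_zero (Nat.pos_of_mem_divisors hH).ne' hc
    rw [← jacobiSym_prod_right _ _ _ h0, Finset.prod_mul_distrib, Finset.prod_const, hj, hm]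
    have : m ^ 2 * c ^ (2 * j) = (m * c ^ j) ^ 2 := by ring
    rw [this, jacobiSym.pow_right]
    apply jacobiSym.sq_one
    rw [← Int.isCoprime_iff_gcd_eq_one]
    have h4 : IsCoprime ((G : ℤ) * d) (∏ H ∈ M.divisors, ((H : ℤ) * c)) :=
      IsCoprime.prod_right fun H hH => hcopGH G hG H hH
    rw [Finset.prod_mul_distrib, Finset.prod_const, hj, ← Nat.cast_prod, hm] at h4
    have h5 : ((m ^ 2 : ℕ) : ℤ) * (c : ℤ) ^ (2 * j) = (m * c ^ j : ℕ) ^ 2 := by push_cast; ring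
    rw [h5] at h4
    exact (IsCoprime.pow_right_iff two_pos).1 h4

/-- The exponent of `exp (2πi/24)` in the transformation law of the Dedekind eta function under
a matrix with odd positive lower left entry. -/
def etaExponent (a b c d : ℤ) : ℤ := (a + d) * c - b * d * (c ^ 2 - 1) - 3 * c + 3

/-- This makes the root of unity in the multiplier of the eta product trivial. Since `h (M/h)² = M
(M/h)`, the cubic terms sum to multiples of `σ(e) σ(M) = σ(eM)`, which `l` makes divisible by 24.
The terms `-3c(M/h) + 3` sum to a multiple of `3 · 2^ω(eM)`, because `2^ω(M) ∣ σ(M)` for odd `M`;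
here `8 ∣ 2^ω(eM) l` suffices. -/
theorem dvd_sum_sum_etaExponent {e M l : ℕ} (hN : Squarefree (e * M)) (hM : Odd M)
    (hσ : 24 ∣ l * sigma 1 (e * M)) (hl : 8 ∣ 2 ^ (e * M).primeFactors.card * l) (a b c d : ℤ) :
    (24 : ℤ) ∣ l * ∑ g ∈ e.divisors, ∑ h ∈ M.divisors,
      etaExponent (g * a) (h * b) ((M / h : ℕ) * c) ((e / g : ℕ) * d) := by
  obtain ⟨hcp, he, hMs⟩ := Nat.squarefree_mul_iff.1 hN
  have hσm : sigma 1 (e * M) = sigma 1 e * sigma 1 M := isMultiplicative_sigma.map_mul_of_coprime hcp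
  have hω : (e * M).primeFactors.card = e.primeFactors.card + M.primeFactors.card := by
    rw [Nat.Coprime.primeFactors_mul hcp, Finset.card_union_of_disjoint hcp.disjoint_primeFactors]
  have sg : ∀ n : ℕ, ∑ g ∈ n.divisors, (g : ℤ) = sigma 1 n := fun n => by
    rw [sigma_one_apply]; push_cast; rfl
  have sG : ∀ n : ℕ, ∑ g ∈ n.divisors, ((n / g : ℕ) : ℤ) = sigma 1 n := fun n => by
    rw [← sg, Nat.sum_div_divisors n (fun d => (d : ℤ))]
  have key : ∀ g ∈ e.divisors, ∀ h ∈ M.divisors,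
      etaExponent (g * a) (h * b) ((M / h : ℕ) * c) ((e / g : ℕ) * d) =
      (a * c * g * (M / h : ℕ) + d * c * (e / g : ℕ) * (M / h : ℕ)
        - b * d * M * c ^ 2 * (e / g : ℕ) * (M / h : ℕ) + b * d * (e / g : ℕ) * h
        - 3 * c * (M / h : ℕ) + 3) := by
    intro g hg h hh
    have hM' : ((M / h : ℕ) : ℤ) * h = M := by
      exact_mod_cast Nat.div_mul_cancel (Nat.dvd_of_mem_divisors hh)
    rw [etaExponent]
    linear_combination (-b * d * (e / g : ℕ) * (M / h : ℕ) * c ^ 2) * hM'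
  rw [Finset.sum_congr rfl fun g hg => Finset.sum_congr rfl fun h hh => key g hg h hh]
  simp only [Finset.sum_add_distrib, Finset.sum_sub_distrib, ← Finset.mul_sum, ← Finset.sum_mul,
    sg, sG, Finset.sum_const, he.card_divisors_eq, hMs.card_divisors_eq]
  have h1 : (24 : ℤ) ∣ l * (sigma 1 e * sigma 1 M) := by
    rw [hσm] at hσ; exact_mod_cast hσ
  have h2 : (8 : ℤ) ∣ 2 ^ e.primeFactors.card * 2 ^ M.primeFactors.card * l := by
    rw [hω, pow_add] at hl; exact_mod_cast hl
  obtain ⟨t, ht⟩ := hMs.two_pow_dvd_sigma hM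
  obtain ⟨x, hx⟩ := h1
  obtain ⟨y, hy⟩ := h2
  have ht' : (sigma 1 M : ℤ) = 2 ^ M.primeFactors.card * t := by exact_mod_cast ht
  refine ⟨x * (a * c + d * c - b * d * M * c ^ 2 + b * d) + y * (1 - c * t), ?_⟩
  simp only [nsmul_eq_mul, Nat.cast_pow, Nat.cast_ofNat]
  linear_combination (a * c + d * c - b * d * M * c ^ 2 + b * d) * hx + 3 * (1 - c * t) * hy
    - 3 * c * 2 ^ e.primeFactors.card * l * ht'

end

/-! ### The transformation law of the Dedekind eta function -/

section

open ModularForm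

/-- The primitive `24`-th root of unity `exp (2πi/24)`. -/
noncomputable def zetaTwentyFour : ℂ := Complex.exp (2 * Real.pi * Complex.I / 24)

local notation "ζ₂₄" => zetaTwentyFour

theorem zetaTwentyFour_ne_zero : ζ₂₄ ≠ 0 := Complex.exp_ne_zero _

theorem zetaTwentyFour_pow_twelve : ζ₂₄ ^ (12 : ℤ) = -1 := by
  rw [zetaTwentyFour, ← Complex.exp_int_mul, ← Complex.exp_pi_mul_I]
  congr 1
  push_cast
  ring

theorem zetaTwentyFour_zpow_eq_one {n : ℤ} (h : 24 ∣ n) : ζ₂₄ ^ n = 1 := by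
  obtain ⟨m, rfl⟩ := h
  rw [show (24 * m : ℤ) = 12 * (2 * m) by ring, zpow_mul, zetaTwentyFour_pow_twelve, zpow_mul]
  norm_num

theorem zetaTwentyFour_pow_three :
    (ζ₂₄ ^ (3 : ℤ)) ^ 2 = Complex.I ∧ (ζ₂₄ ^ (3 : ℤ)).re = (ζ₂₄ ^ (3 : ℤ)).im ∧
      0 < (ζ₂₄ ^ (3 : ℤ)).re := by
  have h : ζ₂₄ ^ (3 : ℤ) = Complex.exp ((Real.pi / 4 : ℝ) * Complex.I) := by
    rw [zetaTwentyFour, ← Complex.exp_int_mul]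
    congr 1
    push_cast
    ring
  refine ⟨?_, ?_, ?_⟩
  · rw [h, ← Complex.exp_nat_mul]
    convert Complex.exp_pi_div_two_mul_I using 2
    push_cast
    ring
  · rw [h, Complex.exp_ofReal_mul_I_re, Complex.exp_ofReal_mul_I_im]
    simp
  · rw [h, Complex.exp_ofReal_mul_I_re, Real.cos_pi_div_four]
    positivity

/-- All branch questions for square roots below are settled this way: compare squares, then check
that both sides lie in the right half-plane. -/
theorem Complex.eq_of_sq_eq_of_re_pos {s t : ℂ} (h : s ^ 2 = t ^ 2) (hs : 0 < s.re)
    (ht : 0 < t.re) : s = t := by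
  rcases sq_eq_sq_iff_eq_or_eq_neg.1 h with h | h
  · exact h
  · rw [h, Complex.neg_re] at hs
    linarith

theorem Complex.sqrt_sq_eq (w : ℂ) : w.sqrt ^ 2 = w := by
  rw [Complex.sqrt, ← Complex.cpow_nat_mul]
  norm_num

theorem Complex.sqrt_re_pos {w : ℂ} (hw : w ∈ Complex.slitPlane) : 0 < w.sqrt.re := by
  have h0 := Complex.slitPlane_ne_zero hw
  rw [Complex.sqrt, Complex.cpow_def_of_ne_zero h0, Complex.exp_re]
  refine mul_pos (Real.exp_pos _) (Real.cos_pos_of_mem_Ioo ?_)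
  have him : (Complex.log w * 2⁻¹).im = w.arg / 2 := by
    rw [show (2⁻¹ : ℂ) = ((2⁻¹ : ℝ) : ℂ) by push_cast; rfl, Complex.im_mul_ofReal, Complex.log_im]
    ring
  rw [him]
  have h1 := Complex.neg_pi_lt_arg w
  have h2 := lt_of_le_of_ne (Complex.arg_le_pi w) (Complex.mem_slitPlane_iff_arg.1 hw).1
  constructor <;> linarith

theorem Complex.abs_sqrt_im_lt {w : ℂ} (hw : 0 < w.re) : |w.sqrt.im| < w.sqrt.re := by
  have h1 := Complex.sqrt_re_pos (Or.inl hw)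
  have h2 : w.re = w.sqrt.re ^ 2 - w.sqrt.im ^ 2 := by
    conv_lhs => rw [← Complex.sqrt_sq_eq w]
    rw [sq, Complex.mul_re]
    ring
  exact abs_lt_of_sq_lt_sq (by linarith) h1.le

theorem Complex.div_I_re (z : ℂ) : (z / Complex.I).re = z.im := by
  simp [Complex.div_I]

theorem eta_add_int (z : ℂ) (n : ℤ) : η (z + n) = ζ₂₄ ^ n * η z := by
  have h1 : ∀ m : ℕ, eta_q m (z + n) = eta_q m z := by
    intro m
    have : Function.Periodic.qParam 1 (z + n) = Function.Periodic.qParam 1 z := by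
      simp only [Function.Periodic.qParam]
      rw [← Complex.exp_periodic.int_mul n (2 * Real.pi * Complex.I * z / (1 : ℝ))]
      congr 1
      push_cast
      ring
    rw [eta_q, eta_q, this]
  simp only [eta, h1]
  rw [← mul_assoc]
  congr 1
  rw [zetaTwentyFour, ← Complex.exp_int_mul, Function.Periodic.qParam, Function.Periodic.qParam,
    ← Complex.exp_add]
  congr 1
  push_cast
  ring

/-- The root is taken of `z / i`, which lies in the right half-plane, rather than of `z` and `i`
separately. The two versions agree because `√z` and `√i` lie in the open first quadrant, so that
their quotient has positive real part. -/
theorem eta_neg_one_div {z : ℂ} (hz : 0 < z.im) :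
    η (-1 / z) = (z / Complex.I).sqrt * η z := by
  have h := eta_comp_eq_csqrt_I_inv (show z ∈ UpperHalfPlane.upperHalfPlaneSet from hz)
  simp only [Function.comp_apply, Pi.smul_apply, Pi.mul_apply, smul_eq_mul] at h
  rw [h, ← mul_assoc]
  congr 1
  have hI : 0 < Complex.I.sqrt.re := Complex.sqrt_re_pos (Or.inr (by simp))
  have hz' : 0 < z.sqrt.re := Complex.sqrt_re_pos (Or.inr hz.ne')
  apply Complex.eq_of_sq_eq_of_re_pos
  · rw [mul_pow, inv_pow, Complex.sqrt_sq_eq, Complex.sqrt_sq_eq, Complex.sqrt_sq_eq]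
    field_simp
  · have e1 : z.im = 2 * z.sqrt.re * z.sqrt.im := by
      conv_lhs => rw [← Complex.sqrt_sq_eq z]
      rw [sq, Complex.mul_im]; ring
    have e2 : 1 = 2 * Complex.I.sqrt.re * Complex.I.sqrt.im := by
      have : Complex.I.im = 2 * Complex.I.sqrt.re * Complex.I.sqrt.im := by
        conv_lhs => rw [← Complex.sqrt_sq_eq Complex.I]
        rw [sq, Complex.mul_im]; ring
      simpa using this
    have p1 : 0 < z.sqrt.im := by
      by_contra hh
      have := mul_nonneg hz'.le (neg_nonneg.2 (not_lt.1 hh))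
      linarith
    have p2 : 0 < Complex.I.sqrt.im := by
      by_contra hh
      have := mul_nonneg hI.le (neg_nonneg.2 (not_lt.1 hh))
      linarith
    have hn : 0 < Complex.normSq Complex.I.sqrt :=
      Complex.normSq_pos.2 fun h0 => by simp [h0] at hI
    rw [Complex.mul_re, Complex.inv_re, Complex.inv_im]
    have : 0 < Complex.I.sqrt.re / Complex.normSq Complex.I.sqrt := div_pos hI hn
    have h3 : 0 < Complex.I.sqrt.im / Complex.normSq Complex.I.sqrt := div_pos p2 hn
    rw [neg_div]
    nlinarith [mul_pos this hz', mul_pos h3 p1]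
  · exact Complex.sqrt_re_pos (Or.inl (by rwa [Complex.div_I_re]))

/-- The transformation law of the Dedekind eta function under `(a b; c d)`, for odd `c > 0`. -/
def EtaLaw (a b : ℤ) (c : ℕ) (d : ℤ) : Prop :=
  ∀ z : ℂ, 0 < z.im → η ((a * z + b) / (c * z + d)) =
    jacobiSym d c * ζ₂₄ ^ etaExponent a b c d * ((c * z + d) / Complex.I).sqrt * η z

theorem dvd_mul_sq_sub_one {c : ℤ} (hc : Odd c) : 24 ∣ c * (c ^ 2 - 1) := by
  obtain ⟨m, rfl⟩ := hc
  have h1 : (8 : ℤ) ∣ (2 * m + 1) ^ 2 - 1 := by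
    obtain ⟨t, ht⟩ := Int.even_mul_succ_self m
    exact ⟨t, by linear_combination 4 * ht⟩
  have h3 : (3 : ℤ) ∣ (2 * m + 1) * ((2 * m + 1) ^ 2 - 1) := by
    generalize 2 * m + 1 = x
    have : x % 3 = 0 ∨ x % 3 = 1 ∨ x % 3 = 2 := by omega
    apply Int.dvd_of_emod_eq_zero
    rcases this with h | h | h <;> simp [Int.mul_emod, Int.sub_emod, pow_two, h]
  exact IsCoprime.mul_dvd (by norm_num : IsCoprime (8 : ℤ) 3) (Dvd.dvd.mul_left h1 _) h3

/-- Right translation by `j` multiplies `η` by `ζ₂₄ ^ j`. The exponent changes by `j` plus a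
multiple of `c (c² - 1)`, which is divisible by 24 for odd `c`, and the Jacobi symbol depends only
on `d` modulo `c`. -/
theorem EtaLaw.shift {a b : ℤ} {c : ℕ} {d : ℤ} (hdet : a * d - b * c = 1) (hc : Odd c)
    (h : EtaLaw a b c d) (j : ℤ) : EtaLaw a (b + j * a) c (d + j * c) := by
  intro z hz
  have h1 := h (z + j) (by simpa using hz)
  have hJ : jacobiSym (d + j * c) c = jacobiSym d c := jacobiSym.mod_left' (by simp)
  have hE : ζ₂₄ ^ etaExponent a (b + j * a) c (d + j * c) = ζ₂₄ ^ etaExponent a b c d * ζ₂₄ ^ j := by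
    obtain ⟨t, ht⟩ := dvd_mul_sq_sub_one (c := c) (by exact_mod_cast hc)
    have : etaExponent a (b + j * a) c (d + j * c) = etaExponent a b c d + j
        + 24 * (-t * (2 * b * j + j ^ 2 * a)) := by
      simp only [etaExponent]
      linear_combination (-(2 * b * j + j ^ 2 * a)) * ht - j * (c ^ 2 - 1) * hdet
    rw [this, zpow_add₀ zetaTwentyFour_ne_zero, zpow_add₀ zetaTwentyFour_ne_zero,
      zetaTwentyFour_zpow_eq_one (Dvd.intro _ rfl), mul_one]
  rw [hJ, hE]
  push_cast
  rw [eta_add_int] at h1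
  rw [show (a : ℂ) * z + (b + j * a) = a * (z + j) + b by ring,
    show (c : ℂ) * z + (d + j * c) = c * (z + j) + d by ring, h1]
  ring

theorem EtaLaw.inversion (a : ℤ) : EtaLaw a (-1) 1 0 := by
  intro z hz
  have hz0 : z ≠ 0 := fun h => by simp [h] at hz
  have : etaExponent a (-1) (1 : ℕ) 0 = a := by simp [etaExponent]
  rw [this]
  simp only [Nat.cast_one, one_mul, Int.cast_zero, add_zero, jacobiSym.one_right, Int.cast_one,
    Int.cast_neg]
  rw [show ((a : ℂ) * z + -1) / z = -1 / z + a by field_simp; ring, eta_add_int,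
    eta_neg_one_div hz]
  ring

theorem neg_one_pow_eq_zetaTwentyFour (n : ℤ) : ζ₂₄ ^ (12 * n) = (-1) ^ n := by
  rw [zpow_mul, zetaTwentyFour_pow_twelve]

theorem chi_four_odd (q : ℕ) : jacobiSym (-1) (2 * q + 1) = (-1) ^ q := by
  rw [jacobiSym.at_neg_one ⟨q, rfl⟩, ZMod.χ₄_eq_neg_one_pow (by omega)]
  congr 1
  omega

/-- Writing `(a b; c d)` as `(b -a; d -c)` composed with `z ↦ -1/z` exchanges the roles of `c` and
`d`; the Jacobi symbols are then matched by quadratic reciprocity. -/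
theorem EtaLaw.swap_pos {a b : ℤ} {c d : ℕ} (hdet : a * d - b * c = 1) (hc : Odd c) (hd : Odd d)
    (h : EtaLaw b (-a) d (-c)) : EtaLaw a b c d := by
  intro z hz
  have hz0 : z ≠ 0 := fun h => by simp [h] at hz
  have hw : 0 < (-1 / z).im := by
    rw [neg_div, Complex.neg_im, one_div, Complex.inv_im, neg_div, neg_neg]
    exact div_pos hz (Complex.normSq_pos.2 hz0)
  have hc0 : (0 : ℝ) < c := by exact_mod_cast hc.pos
  have hd0 : (0 : ℝ) < d := by exact_mod_cast hd.pos
  have h1 := h _ hw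
  rw [eta_neg_one_div hz] at h1
  have harg : ((b : ℂ) * (-1 / z) + (-a : ℤ)) / (d * (-1 / z) + (-c : ℤ)) =
      (a * z + b) / (c * z + (d : ℤ)) := by
    push_cast
    rw [← mul_div_mul_right _ _ (neg_ne_zero.2 hz0)]
    congr 1 <;> field_simp <;> ring
  rw [harg] at h1
  -- Roots of points of the right half-plane have argument in `(-π/4, π/4)`, so a product of two of
  -- them, or of one with `ζ₂₄ ^ 3 = exp (πi/4)`, keeps positive real part.
  have hs : ((d * (-1 / z) + (-c : ℤ)) / Complex.I).sqrt * (z / Complex.I).sqrt =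
      ζ₂₄ ^ (3 : ℤ) * ((c * z + (d : ℤ)) / Complex.I).sqrt := by
    obtain ⟨k1, k2, k3⟩ := zetaTwentyFour_pow_three
    have r1 : 0 < ((d * (-1 / z) + (-c : ℤ)) / Complex.I).re := by
      rw [Complex.div_I_re]
      have : ((d : ℂ) * (-1 / z) + (-c : ℤ)).im = d * (-1 / z).im := by
        simp
      rw [this]; positivity
    have r2 : 0 < (z / Complex.I).re := by rwa [Complex.div_I_re]
    have r3 : 0 < ((c * z + (d : ℤ)) / Complex.I).re := by
      rw [Complex.div_I_re]; simp; positivity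
    have q1 := Complex.abs_sqrt_im_lt r1
    have q2 := Complex.abs_sqrt_im_lt r2
    have q3 := Complex.abs_sqrt_im_lt r3
    apply Complex.eq_of_sq_eq_of_re_pos
    · rw [mul_pow, mul_pow, k1, Complex.sqrt_sq_eq, Complex.sqrt_sq_eq, Complex.sqrt_sq_eq]
      field_simp
      rw [Complex.I_sq]
      push_cast
      ring
    · rw [Complex.mul_re]
      rw [abs_lt] at q1 q2
      nlinarith
    · rw [Complex.mul_re, ← k2, ← mul_sub]
      rw [abs_lt] at q3
      exact mul_pos k3 (by linarith)
  obtain ⟨p, rfl⟩ := hc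
  obtain ⟨q, rfl⟩ := hd
  have hJE : (jacobiSym ((2 * q + 1 : ℕ) : ℤ) (2 * p + 1) : ℂ) *
      ζ₂₄ ^ etaExponent a b (2 * p + 1 : ℕ) (2 * q + 1 : ℕ) =
      jacobiSym (-((2 * p + 1 : ℕ) : ℤ)) (2 * q + 1) *
        ζ₂₄ ^ etaExponent b (-a) (2 * q + 1 : ℕ) (-(2 * p + 1 : ℕ)) * ζ₂₄ ^ (3 : ℤ) := by
    -- As `ζ₂₄ ^ 12 = -1`, the last summand is the sign `(-1)^(pq)` of reciprocity times the sign
    -- `(-1)^q` of `-1` modulo `2q + 1`.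
    have hE : etaExponent a b (2 * p + 1 : ℕ) (2 * q + 1 : ℕ) =
        etaExponent b (-a) (2 * q + 1 : ℕ) (-(2 * p + 1 : ℕ)) + 3 + 12 * (((p + 1) * q : ℕ) : ℤ) := by
      simp only [etaExponent]
      push_cast at hdet ⊢
      linear_combination (2 * p + 1 : ℤ) * (2 * q + 1) * hdet
    rw [hE, zpow_add₀ zetaTwentyFour_ne_zero, zpow_add₀ zetaTwentyFour_ne_zero,
      neg_one_pow_eq_zetaTwentyFour, jacobiSym.quadratic_reciprocity ⟨q, rfl⟩ ⟨p, rfl⟩,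
      jacobiSym.neg _ ⟨q, rfl⟩, ← jacobiSym.at_neg_one ⟨q, rfl⟩, chi_four_odd,
      show (2 * q + 1) / 2 = q by omega, show (2 * p + 1) / 2 = p by omega, zpow_natCast]
    push_cast
    have e1 : ((-1 : ℂ) ^ (q * p)) * (-1) ^ ((p + 1) * q) = (-1) ^ q := by
      rw [← pow_add, show q * p + (p + 1) * q = 2 * (q * p) + q by ring, pow_add, pow_mul]
      norm_num
    rw [← e1]
    ring
  rw [hJE, h1]
  linear_combination (jacobiSym (-((2 * p + 1 : ℕ) : ℤ)) (2 * q + 1) *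
        ζ₂₄ ^ etaExponent b (-a) (2 * q + 1 : ℕ) (-(2 * p + 1 : ℕ)) * η z) * hs

/-- The same exchange for a negative lower right entry: the matrix is negated so that the new lower
left entry `d` is positive, and `ζ₂₄ ^ 3` moves to the other side. -/
theorem EtaLaw.swap_neg {a b : ℤ} {c d : ℕ} (hdet : a * (-d) - b * c = 1) (hc : Odd c) (hd : Odd d)
    (h : EtaLaw (-b) a d c) : EtaLaw a b c (-d) := by
  intro z hz
  have hz0 : z ≠ 0 := fun h => by simp [h] at hz
  have hw : 0 < (-1 / z).im := by
    rw [neg_div, Complex.neg_im, one_div, Complex.inv_im, neg_div, neg_neg]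
    exact div_pos hz (Complex.normSq_pos.2 hz0)
  have hc0 : (0 : ℝ) < c := by exact_mod_cast hc.pos
  have hd0 : (0 : ℝ) < d := by exact_mod_cast hd.pos
  have h1 := h _ hw
  rw [eta_neg_one_div hz] at h1
  have harg : (((-b : ℤ) : ℂ) * (-1 / z) + a) / (d * (-1 / z) + (c : ℤ)) =
      (a * z + b) / (c * z + (-d : ℤ)) := by
    push_cast
    rw [← mul_div_mul_right _ _ hz0]
    congr 1 <;> field_simp <;> ring
  rw [harg] at h1
  have hs : ((d * (-1 / z) + (c : ℤ)) / Complex.I).sqrt * (z / Complex.I).sqrt * ζ₂₄ ^ (3 : ℤ) =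
      ((c * z + (-d : ℤ)) / Complex.I).sqrt := by
    obtain ⟨k1, k2, k3⟩ := zetaTwentyFour_pow_three
    have r1 : 0 < ((d * (-1 / z) + (c : ℤ)) / Complex.I).re := by
      rw [Complex.div_I_re]
      have : ((d : ℂ) * (-1 / z) + (c : ℤ)).im = d * (-1 / z).im := by
        simp
      rw [this]; positivity
    have r2 : 0 < (z / Complex.I).re := by rwa [Complex.div_I_re]
    have r3 : 0 < ((c * z + (-d : ℤ)) / Complex.I).re := by
      rw [Complex.div_I_re]; simp; positivity
    have q1 := Complex.abs_sqrt_im_lt r1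
    have q2 := Complex.abs_sqrt_im_lt r2
    have q3 := Complex.abs_sqrt_im_lt r3
    have k0 : ζ₂₄ ^ (3 : ℤ) ≠ 0 := zpow_ne_zero _ zetaTwentyFour_ne_zero
    rw [← eq_mul_inv_iff_mul_eq₀ k0]
    apply Complex.eq_of_sq_eq_of_re_pos
    · rw [mul_pow, mul_pow, inv_pow, k1, Complex.sqrt_sq_eq, Complex.sqrt_sq_eq, Complex.sqrt_sq_eq]
      field_simp
      push_cast
      ring
    · rw [Complex.mul_re]
      rw [abs_lt] at q1 q2
      nlinarith
    · have hn : 0 < Complex.normSq (ζ₂₄ ^ (3 : ℤ)) := Complex.normSq_pos.2 k0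
      rw [Complex.mul_re, Complex.inv_re, Complex.inv_im, ← k2]
      rw [abs_lt] at q3
      have := div_pos k3 hn
      rw [neg_div]
      nlinarith
  obtain ⟨p, rfl⟩ := hc
  obtain ⟨q, rfl⟩ := hd
  have hJE : (jacobiSym (-((2 * q + 1 : ℕ) : ℤ)) (2 * p + 1) : ℂ) *
      ζ₂₄ ^ etaExponent a b (2 * p + 1 : ℕ) (-(2 * q + 1 : ℕ)) * ζ₂₄ ^ (3 : ℤ) =
      jacobiSym ((2 * p + 1 : ℕ) : ℤ) (2 * q + 1) *
        ζ₂₄ ^ etaExponent (-b) a (2 * q + 1 : ℕ) (2 * p + 1 : ℕ) := by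
    have hE : etaExponent (-b) a (2 * q + 1 : ℕ) (2 * p + 1 : ℕ) =
        etaExponent a b (2 * p + 1 : ℕ) (-(2 * q + 1 : ℕ)) + 3 + 12 * (((q + 1) * p : ℕ) : ℤ) := by
      simp only [etaExponent]
      push_cast at hdet ⊢
      linear_combination (2 * p + 1 : ℤ) * (2 * q + 1) * hdet
    rw [hE, zpow_add₀ zetaTwentyFour_ne_zero, zpow_add₀ zetaTwentyFour_ne_zero,
      neg_one_pow_eq_zetaTwentyFour, jacobiSym.neg _ ⟨p, rfl⟩, ← jacobiSym.at_neg_one ⟨p, rfl⟩,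
      chi_four_odd, jacobiSym.quadratic_reciprocity ⟨q, rfl⟩ ⟨p, rfl⟩,
      show (2 * q + 1) / 2 = q by omega, show (2 * p + 1) / 2 = p by omega, zpow_natCast]
    push_cast
    have e1 : (-1 : ℂ) ^ p * (-1) ^ (q * p) = (-1) ^ ((q + 1) * p) := by
      rw [← pow_add]; congr 1; ring
    rw [← e1]
    ring
  rw [h1, ← hs, ← hJE]
  ring

/-- The transformation law of the Dedekind eta function under an integral unimodular matrix with
odd positive lower left entry. -/
theorem etaLaw_of_odd (c : ℕ) (hc : Odd c) (a b d : ℤ) (hdet : a * d - b * c = 1) :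
    EtaLaw a b c d := by
  induction c using Nat.strong_induction_on generalizing a b d with
  | _ c ih =>
    rcases eq_or_ne c 1 with rfl | hc1
    · have h := (EtaLaw.inversion a).shift (by simp) odd_one d
      have hb : b = -1 + d * a := by push_cast at hdet; linarith
      rw [hb]
      simpa using h
    · -- it suffices to treat one representative of `d` modulo `c`
      have red : ∀ j : ℤ, EtaLaw a (b - j * a) c (d - j * c) → EtaLaw a b c d := fun j h => by
        have := h.shift (by linear_combination hdet) hc j
        simpa using this
      have hc0 : (0 : ℤ) < c := by exact_mod_cast hc.pos
      have hm : d - d / c * c = d % c := by rw [Int.emod_def]; ring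
      have hm0 := Int.emod_nonneg d hc0.ne'
      have hmc := Int.emod_lt_of_pos d hc0
      have hmne : d % c ≠ 0 := fun h0 => by
        obtain ⟨t, rfl⟩ := Int.dvd_of_emod_eq_zero h0
        have : (c : ℤ) ∣ 1 := ⟨a * t - b, by linear_combination -hdet⟩
        have := Int.natCast_dvd_natCast.1 (by exact_mod_cast this : ((c : ℕ) : ℤ) ∣ ((1 : ℕ) : ℤ))
        exact hc1 (Nat.dvd_one.1 this)
      -- Modulo the odd number `c`, `d` has an odd representative smaller than `c` in absolute
      -- value: `d % c`, or `d % c - c` if the former is even. The swap then lowers `c` and keeps it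
      -- odd, as a Euclidean algorithm in odd numbers.
      rcases Int.even_or_odd (d % c) with hev | hod
      · obtain ⟨D, hD⟩ : ∃ D : ℕ, (D : ℤ) = c - d % c := ⟨(c - d % c).toNat, by omega⟩
        have hDo : Odd D := by
          have : Odd (c - d % c : ℤ) := Odd.sub_even (by exact_mod_cast hc) hev
          rw [← hD] at this
          exact_mod_cast this
        apply red (d / c + 1)
        rw [show d - (d / c + 1) * c = -(D : ℤ) by rw [hD, ← hm]; ring]
        have hdet' : a * (-(D : ℤ)) - (b - (d / c + 1) * a) * c = 1 := by
          rw [hD, ← hm]; linear_combination hdet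
        exact EtaLaw.swap_neg hdet' hc hDo (ih D (by omega) hDo _ _ _ (by linear_combination hdet'))
      · obtain ⟨D, hD⟩ : ∃ D : ℕ, (D : ℤ) = d % c := ⟨(d % c).toNat, by omega⟩
        have hDo : Odd D := by
          rw [← hD] at hod
          exact_mod_cast hod
        apply red (d / c)
        rw [hm, ← hD]
        have hdet' : a * (D : ℤ) - (b - d / c * a) * c = 1 := by
          rw [hD, ← hm]; linear_combination hdet
        exact EtaLaw.swap_pos hdet' hc hDo (ih D (by omega) hDo _ _ _ (by linear_combination hdet'))

end

/-! ### Atkin–Lehner matrices: arithmeticity, cusps and a reduced set of matrices for invariance -/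

section

open Matrix UpperHalfPlane
open scoped MatrixGroups ModularForm

/-- `g` is the Atkin–Lehner matrix `e^{-1/2} (ea b; eMc ed)` with `ead - Mbc = 1`. -/
structure IsAtkinLehner (e M : ℕ) (a b c d : ℤ) (g : GL (Fin 2) ℝ) : Prop where
  pos : 0 < e
  det : e * a * d - M * b * c = 1
  coe_eq : (g : Matrix (Fin 2) (Fin 2) ℝ) =
    (Real.sqrt e)⁻¹ • !![(e * a : ℝ), b; (e * M * c : ℝ), e * d]

theorem IsAtkinLehner.sqrt_ne_zero {e M : ℕ} {a b c d : ℤ} {g : GL (Fin 2) ℝ}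
    (h : IsAtkinLehner e M a b c d g) : Real.sqrt e ≠ 0 :=
  (Real.sqrt_pos.2 (by exact_mod_cast h.pos)).ne'

theorem IsAtkinLehner.det_matrix {e : ℕ} (M : ℕ) {a b c d : ℤ} (he : 0 < e)
    (h : e * a * d - M * b * c = 1) :
    ((Real.sqrt e)⁻¹ • !![(e * a : ℝ), b; (e * M * c : ℝ), e * d]).det = 1 := by
  have h1 : ((e : ℝ) * a * d - M * b * c) = 1 := by exact_mod_cast h
  have he' : (0 : ℝ) < e := by exact_mod_cast he
  rw [Matrix.det_smul, Matrix.det_fin_two_of, Fintype.card_fin, inv_pow, Real.sq_sqrt he'.le]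
  field_simp
  linear_combination h1

theorem IsAtkinLehner.exists {e : ℕ} (M : ℕ) {a b c d : ℤ} (he : 0 < e)
    (h : e * a * d - M * b * c = 1) : ∃ g, IsAtkinLehner e M a b c d g :=
  ⟨SpecialLinearGroup.toGL ⟨_, IsAtkinLehner.det_matrix M he h⟩, he, h, rfl⟩

theorem IsAtkinLehner.det_eq {e M : ℕ} {a b c d : ℤ} {g : GL (Fin 2) ℝ}
    (h : IsAtkinLehner e M a b c d g) : g.det.val = 1 := by
  rw [Matrix.GeneralLinearGroup.val_det_apply, h.coe_eq, IsAtkinLehner.det_matrix M h.pos h.det]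

theorem mem_moonshineLevel_iff {N : ℕ} {g : GL (Fin 2) ℝ} :
    g ∈ moonshineLevel N ↔ ∃ e M a b c d, e * M = N ∧ IsAtkinLehner e M a b c d g := by
  constructor
  · rintro ⟨γ, ⟨e, a, b, c, d, he, ⟨M, rfl⟩, hdet, ⟨a', rfl⟩, ⟨d', rfl⟩, ⟨c', rfl⟩, hg⟩, rfl⟩
    refine ⟨e, M, a', b, c', d', rfl, he, ?_, ?_⟩
    · have he' : (e : ℤ) ≠ 0 := by exact_mod_cast he.ne'
      apply mul_left_cancel₀ he'
      push_cast at hdet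
      linear_combination hdet
    · change (γ : Matrix (Fin 2) (Fin 2) ℝ) = _
      rw [hg]
      push_cast
      rfl
  · rintro ⟨e, M, a, b, c, d, rfl, h⟩
    refine ⟨⟨_, IsAtkinLehner.det_matrix M h.pos h.det⟩,
      ⟨e, e * a, b, e * M * c, e * d, h.pos, ⟨M, rfl⟩, ?_, ⟨a, rfl⟩, ⟨d, rfl⟩,
        ⟨c, by push_cast; rfl⟩, ?_⟩, ?_⟩
    · linear_combination (e : ℤ) * h.det
    · push_cast; rfl
    · ext i j
      change ((Real.sqrt e)⁻¹ • !![(e * a : ℝ), b; (e * M * c : ℝ), e * d]) i j = _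
      rw [h.coe_eq]

theorem IsAtkinLehner.neg {e M : ℕ} {a b c d : ℤ} {g : GL (Fin 2) ℝ}
    (h : IsAtkinLehner e M a b c d g) : IsAtkinLehner e M (-a) (-b) (-c) (-d) (-g) := by
  refine ⟨h.pos, by linear_combination h.det, ?_⟩
  rw [Units.val_neg, h.coe_eq]
  ext i j
  fin_cases i <;> fin_cases j <;> simp

theorem IsAtkinLehner.mul_lower {e M : ℕ} {a b c d : ℤ} {g w : GL (Fin 2) ℝ}
    (h : IsAtkinLehner e M a b c d g) (hw : IsAtkinLehner 1 (e * M) 1 0 1 1 w) :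
    IsAtkinLehner e M (a + b * M) b (c + e * d) d (g * w) := by
  refine ⟨h.pos, by linear_combination h.det, ?_⟩
  rw [Units.val_mul, h.coe_eq, hw.coe_eq]
  ext i j
  fin_cases i <;> fin_cases j <;> simp [Matrix.mul_apply, Fin.sum_univ_two] <;> ring

/-- The Fricke involution exchanges `e` and `M`, which later allows `M` to be assumed odd. -/
theorem IsAtkinLehner.mul_fricke {e M : ℕ} {a b c d : ℤ} {g w : GL (Fin 2) ℝ}
    (h : IsAtkinLehner e M a b c d g) (hw : IsAtkinLehner (e * M) 1 0 (-1) 1 0 w) :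
    IsAtkinLehner M e b (-a) d (-c) (g * w) := by
  have hM := Nat.pos_of_mul_pos_left hw.pos
  refine ⟨hM, by linear_combination h.det, ?_⟩
  rw [Units.val_mul, h.coe_eq, hw.coe_eq]
  have he' : (0 : ℝ) < e := by exact_mod_cast h.pos
  have hM' : (0 : ℝ) < M := by exact_mod_cast hM
  have hs : (Real.sqrt e)⁻¹ * (Real.sqrt (e * M))⁻¹ = (Real.sqrt M)⁻¹ * (e : ℝ)⁻¹ := by
    rw [Real.sqrt_mul he'.le, mul_inv, ← mul_assoc, ← mul_inv, Real.mul_self_sqrt he'.le, mul_comm]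
  rw [Matrix.smul_mul, Matrix.mul_smul, smul_smul, Nat.cast_mul, hs, mul_smul]
  congr 1
  ext i j
  fin_cases i <;> fin_cases j <;> simp <;> field_simp

/-- The integral matrix `γ⁻¹ γ'` for two Atkin–Lehner matrices with the same `e`. -/
theorem IsAtkinLehner.inv_mul_mem {e M : ℕ} {a b c d a' b' c' d' : ℤ} {g g' : GL (Fin 2) ℝ}
    (h : IsAtkinLehner e M a b c d g) (h' : IsAtkinLehner e M a' b' c' d' g') :
    g⁻¹ * g' ∈ (CongruenceSubgroup.Gamma0 (e * M) : Subgroup (GL (Fin 2) ℝ)) := by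
  have he' : (0 : ℝ) < e := by exact_mod_cast h.pos
  obtain ⟨γ, hγ⟩ : ∃ γ : SL(2, ℤ), (γ : Matrix (Fin 2) (Fin 2) ℤ) =
      !![e * d * a' - M * b * c', d * b' - b * d';
        e * M * (a * c' - c * a'), e * a * d' - M * c * b'] := by
    refine ⟨⟨_, ?_⟩, rfl⟩
    rw [Matrix.det_fin_two_of]
    linear_combination h.det + (e * a * d - M * b * c : ℤ) * h'.det
  refine ⟨γ, ?_, ?_⟩
  · rw [SetLike.mem_coe, CongruenceSubgroup.Gamma0_mem, ZMod.intCast_zmod_eq_zero_iff_dvd, hγ]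
    exact ⟨a * c' - c * a', by simp⟩
  · rw [eq_inv_mul_iff_mul_eq]
    apply Units.ext
    rw [Units.val_mul, SpecialLinearGroup.mapGL_coe_matrix, h.coe_eq, h'.coe_eq, Matrix.smul_mul]
    congr 1
    have hd : ((e : ℝ) * a * d - M * b * c) = 1 := by exact_mod_cast h.det
    ext i j
    fin_cases i <;> fin_cases j <;> simp [Matrix.mul_apply, Fin.sum_univ_two, hγ]
    · linear_combination (e * a' : ℝ) * hd
    · linear_combination (b' : ℝ) * hd
    · linear_combination (e * M * c' : ℝ) * hd
    · linear_combination (e * d' : ℝ) * hd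

theorem gamma0_le_moonshineLevel (N : ℕ) :
    (CongruenceSubgroup.Gamma0 N : Subgroup (GL (Fin 2) ℝ)) ≤ moonshineLevel N := by
  rintro _ ⟨γ, hγ, rfl⟩
  rw [SetLike.mem_coe, CongruenceSubgroup.Gamma0_mem, ZMod.intCast_zmod_eq_zero_iff_dvd] at hγ
  obtain ⟨c, hc⟩ := hγ
  refine mem_moonshineLevel_iff.2 ⟨1, N, γ 0 0, γ 0 1, c, γ 1 1, one_mul N, one_pos, ?_, ?_⟩
  · have := γ.det_coe
    rw [Matrix.det_fin_two, hc] at this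
    push_cast
    linear_combination this
  · rw [SpecialLinearGroup.mapGL_coe_matrix]
    ext i j
    fin_cases i <;> fin_cases j <;> simp [hc]

instance isArithmetic_moonshineLevel (N : ℕ) [NeZero N] : (moonshineLevel N).IsArithmetic := by
  have h1 : (CongruenceSubgroup.Gamma0 N : Subgroup (GL (Fin 2) ℝ)).relIndex (moonshineLevel N)
      ≠ 0 := by
    have hmem := fun q : moonshineLevel N ⧸ (CongruenceSubgroup.Gamma0 N :
      Subgroup (GL (Fin 2) ℝ)).subgroupOf (moonshineLevel N) => mem_moonshineLevel_iff.1 q.out.2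
    choose e M a b c d heM hal using hmem
    have hle : ∀ q, e q < N + 1 := fun q =>
      Nat.lt_succ_of_le (Nat.le_of_dvd (NeZero.pos N) ⟨M q, (heM q).symm⟩)
    have : Finite (moonshineLevel N ⧸ (CongruenceSubgroup.Gamma0 N :
        Subgroup (GL (Fin 2) ℝ)).subgroupOf (moonshineLevel N)) := by
      -- A left coset of `Γ₀(N)` is determined by `e`, of which there are finitely many values.
      refine Finite.of_injective (fun q => (⟨e q, hle q⟩ : Fin (N + 1))) fun q q' hq => ?_
      have he : e q = e q' := by simpa using hq
      have hM : M q = M q' := by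
        have h2 := (heM q).trans (heM q').symm
        rw [he] at h2
        exact Nat.eq_of_mul_eq_mul_left (hal q').pos h2
      have h3 := hal q'
      rw [← he, ← hM] at h3
      have h4 := (hal q).inv_mul_mem h3
      rw [heM q] at h4
      rw [← q.out_eq', ← q'.out_eq']
      exact QuotientGroup.eq.2 h4
    exact Subgroup.index_ne_zero_of_finite
  have h2 : (CongruenceSubgroup.Gamma0 N : Subgroup (GL (Fin 2) ℝ)).IsArithmetic := inferInstance
  have h3 : (CongruenceSubgroup.Gamma0 N : Subgroup (GL (Fin 2) ℝ)) ≤ 𝒮ℒ := by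
    rintro _ ⟨γ, -, rfl⟩
    exact ⟨γ, rfl⟩
  refine ⟨fun h0 => h2.is_commensurable.1 ?_, fun h0 => h1 ?_⟩
  · exact Nat.eq_zero_of_zero_dvd (h0 ▸ Subgroup.relIndex_dvd_of_le_left _
      (gamma0_le_moonshineLevel N))
  · exact Nat.eq_zero_of_zero_dvd (h0 ▸ Subgroup.relIndex_dvd_of_le_left _ h3)

/-- For squarefree `N`, every cusp of `Γ₀(N)⁺` is equivalent to `∞`. -/
theorem exists_smul_infty_of_isCusp {N : ℕ} (hN : Squarefree N) {x : OnePoint ℝ}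
    (hx : IsCusp x (moonshineLevel N)) : ∃ g ∈ moonshineLevel N, g • OnePoint.infty = x := by
  have : NeZero N := ⟨hN.ne_zero⟩
  rw [Subgroup.IsArithmetic.isCusp_iff_isCusp_SL2Z, isCusp_SL2Z_iff'] at hx
  obtain ⟨γ, rfl⟩ := hx
  -- With `M` the gcd of the denominator and `N`, and `e = N / M`, squarefreeness makes `e` prime to
  -- the denominator. Hence `(e · γ 0 0, e · γ 1 0)` can be completed to the first column of an
  -- Atkin–Lehner matrix, which sends `∞` to the given cusp.
  obtain ⟨e, he⟩ := Int.gcd_dvd_natAbs_right (γ 1 0) N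
  obtain ⟨c, hc⟩ := Int.gcd_dvd_left (γ 1 0) N
  set M := Int.gcd (γ 1 0) N with hM
  rw [Int.natAbs_natCast] at he
  have hMpos : 0 < M := Nat.pos_of_mul_pos_right (he ▸ NeZero.pos N)
  have hepos : 0 < e := Nat.pos_of_mul_pos_left (he ▸ NeZero.pos N)
  have hdet := γ.det_coe
  rw [Matrix.det_fin_two] at hdet
  have h1 : IsCoprime (γ 0 0) (M * c) := ⟨γ 1 1, -γ 0 1, by rw [← hc]; linear_combination hdet⟩
  have h2 : IsCoprime (e : ℤ) (M * c) := by
    have hMe : M.Coprime e := Nat.coprime_of_squarefree_mul (he ▸ hN)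
    refine IsCoprime.mul_right (Nat.isCoprime_iff_coprime.2 hMe.symm) ?_
    have h3 : Int.gcd (M * c) (M * e : ℕ) = M := by rw [← he, ← hc]
    rw [Nat.cast_mul, Int.gcd_mul_left, Int.natAbs_natCast] at h3
    have h4 : Int.gcd c e = 1 := by
      apply Nat.eq_of_mul_eq_mul_left hMpos
      rw [h3, mul_one]
    exact (Int.isCoprime_iff_gcd_eq_one.2 h4).symm
  obtain ⟨d, b, hdb⟩ := h2.mul_left h1
  obtain ⟨g, hg⟩ := IsAtkinLehner.exists (e := e) M (a := γ 0 0) (b := -b) (c := c) (d := d) hepos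
    (by linear_combination hdb)
  refine ⟨g, mem_moonshineLevel_iff.2 ⟨_, _, _, _, _, _, by rw [he, mul_comm], hg⟩, ?_⟩
  have hs := hg.sqrt_ne_zero
  have he' : (e : ℝ) ≠ 0 := by exact_mod_cast hepos.ne'
  have hM' : (M : ℝ) ≠ 0 := by exact_mod_cast hMpos.ne'
  have hc' : ((γ 1 0 : ℤ) : ℝ) = M * c := by exact_mod_cast hc
  rw [OnePoint.smul_infty_eq_ite, OnePoint.smul_infty_eq_ite, hg.coe_eq,
    SpecialLinearGroup.mapGL_coe_matrix]
  simp only [smul_of, smul_cons, smul_eq_mul, smul_empty, of_apply, cons_val', cons_val_zero,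
    cons_val_one, SpecialLinearGroup.map_apply_coe, RingHom.mapMatrix_apply, Matrix.map_apply,
    algebraMap_int_eq, eq_intCast, hc']
  rcases eq_or_ne (c : ℝ) 0 with h0 | h0
  · simp [h0]
  · rw [if_neg (by simp [hs, he', hM', h0]), if_neg (by simp [hM', h0])]
    congr 1
    field_simp

/-- If `w` and `g * w` fix `f`, so does `g`. A negative `c` is handled by `-g`, as `k` is even. If
`c` is even and `M` odd, the determinant makes `e` and `d` odd, so a lower triangular `w` replaces
`c` by the odd `c + ed`. If `M` is even, then `e` is odd by squarefreeness and the Fricke involution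
exchanges the two. -/
theorem slash_eq_self_of_mem_moonshineLevel {N : ℕ} {k : ℤ} (hk : Even k) (hN : Squarefree N)
    {f : ℍ → ℂ}
    (hf : ∀ (e M : ℕ) (a b : ℤ) (c : ℕ) (d : ℤ) (g : GL (Fin 2) ℝ), e * M = N → Odd M → Odd c →
      IsAtkinLehner e M a b c d g → f ∣[k] g = f)
    {g : GL (Fin 2) ℝ} (hg : g ∈ moonshineLevel N) : f ∣[k] g = f := by
  have hdiv : ∀ g w : GL (Fin 2) ℝ, f ∣[k] w = f → f ∣[k] (g * w) = f → f ∣[k] g = f := by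
    intro g w h1 h2
    calc f ∣[k] g = (f ∣[k] (g * w)) ∣[k] w⁻¹ := by
          rw [← SlashAction.slash_mul, mul_inv_cancel_right]
      _ = (f ∣[k] w) ∣[k] w⁻¹ := by rw [h1, h2]
      _ = f := by rw [← SlashAction.slash_mul, mul_inv_cancel, SlashAction.slash_one]
  have hodd : ∀ (e M : ℕ) (a b c d : ℤ) (g : GL (Fin 2) ℝ), e * M = N → Odd M → Odd c →
      IsAtkinLehner e M a b c d g → f ∣[k] g = f := by
    intro e M a b c d g heM hM hc h
    obtain ⟨n, rfl | rfl⟩ := Int.eq_nat_or_neg c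
    · exact hf e M a b n d g heM hM (by exact_mod_cast hc) h
    · have h1 := h.neg
      rw [neg_neg] at h1
      have h2 := hf e M _ _ n _ _ heM hM (by simpa using hc) h1
      have h3 : f ∣[k] (-g) = f ∣[k] g := by
        ext τ
        simp [ModularForm.slash_def, UpperHalfPlane.denom_neg, hk.neg_zpow, Matrix.det_neg]
      rw [← h3, h2]
  have hoddM : ∀ (e M : ℕ) (a b c d : ℤ) (g : GL (Fin 2) ℝ), e * M = N → Odd M →
      IsAtkinLehner e M a b c d g → f ∣[k] g = f := by
    intro e M a b c d g heM hM h
    rcases Int.even_or_odd c with hc | hc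
    · obtain ⟨w, hw⟩ := IsAtkinLehner.exists (e := 1) (e * M) (a := 1) (b := 0) (c := 1) (d := 1)
        one_pos (by simp)
      have h1 : Odd ((e : ℤ) * a * d) := by
        have : (e : ℤ) * a * d = 1 + M * b * c := by linear_combination h.det
        rw [this]
        exact odd_one.add_even (hc.mul_left _)
      have he := Int.Odd.of_mul_left (Int.Odd.of_mul_left h1)
      have hd := Int.Odd.of_mul_right h1
      exact hdiv g w (hodd 1 (e * M) 1 0 1 1 w (by rw [one_mul, heM])
        (Nat.odd_mul.2 ⟨by exact_mod_cast he, hM⟩) odd_one hw)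
        (hodd _ _ _ _ _ _ _ heM hM (hc.add_odd (he.mul hd)) (h.mul_lower hw))
    · exact hodd e M a b c d g heM hM hc h
  obtain ⟨e, M, a, b, c, d, heM, h⟩ := mem_moonshineLevel_iff.1 hg
  rcases Nat.even_or_odd M with hM | hM
  · have he : Odd e := by
      have hcop : e.Coprime M := Nat.coprime_of_squarefree_mul (heM ▸ hN)
      rw [← Nat.not_even_iff_odd]
      intro he
      exact absurd (Nat.dvd_gcd he.two_dvd hM.two_dvd) (by rw [hcop.gcd_eq_one]; norm_num)
    obtain ⟨w, hw⟩ := IsAtkinLehner.exists (e := e * M) 1 (a := 0) (b := -1) (c := 1) (d := 0)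
      (heM ▸ hN.ne_zero.bot_lt) (by simp)
    exact hdiv g w (hodd _ _ _ _ _ _ _ (by rw [mul_one, heM]) odd_one odd_one hw)
      (hoddM _ _ _ _ _ _ _ (by rw [mul_comm, heM]) he (h.mul_fricke hw))
  · exact hoddM e M a b c d g heM hM h

end

/-! ### The eta product as a cusp form -/

section

open Matrix UpperHalfPlane ModularForm
open scoped MatrixGroups ModularForm

local notation "ζ₂₄" => zetaTwentyFour
local notation "𝕢" => Function.Periodic.qParam

/-- The function `τ ↦ ∏_{v ∣ N} η(vτ)^l` on the upper half-plane. -/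
noncomputable def etaProd (N l : ℕ) (τ : ℍ) : ℂ := ∏ v ∈ N.divisors, η (v * τ) ^ l

theorem Complex.sqrt_natCast_mul {n : ℕ} (hn : 0 < n) {w : ℂ} (hw : 0 < w.re) :
    (n * w).sqrt = (Real.sqrt n : ℂ) * w.sqrt := by
  have hn' : (0 : ℝ) < n := by exact_mod_cast hn
  apply Complex.eq_of_sq_eq_of_re_pos
  · rw [mul_pow, Complex.sqrt_sq_eq, Complex.sqrt_sq_eq, ← Complex.ofReal_pow,
      Real.sq_sqrt hn'.le, Complex.ofReal_natCast]
  · refine Complex.sqrt_re_pos (Or.inl ?_)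
    rw [← Complex.ofReal_natCast, Complex.re_ofReal_mul]
    exact mul_pos hn' hw
  · rw [Complex.re_ofReal_mul]
    exact mul_pos (Real.sqrt_pos.2 hn') (Complex.sqrt_re_pos (Or.inl hw))

theorem im_natCast_mul_pos {n : ℕ} (hn : 0 < n) (τ : ℍ) : 0 < ((n : ℂ) * τ).im := by
  rw [← Complex.ofReal_natCast, Complex.im_ofReal_mul]
  exact mul_pos (by exact_mod_cast hn) τ.im_pos

theorem slash_apply_of_det_eq_one {g : GL (Fin 2) ℝ} (hg : g.det.val = 1) (k : ℤ) (f : ℍ → ℂ)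
    (τ : ℍ) : (f ∣[k] g) τ = f (g • τ) * denom g τ ^ (-k) := by
  have hσ : σ g = ContinuousAlgEquiv.refl ℝ ℂ := by rw [σ, if_pos (by rw [hg]; exact one_pos)]
  rw [ModularForm.slash_def]
  simp only [hg, hσ]
  simp

theorem IsAtkinLehner.denom_eq {e M : ℕ} {a b c d : ℤ} {g : GL (Fin 2) ℝ}
    (hg : IsAtkinLehner e M a b c d g) (τ : ℍ) :
    denom g τ = (Real.sqrt e : ℂ) * (M * c * τ + d) := by
  have he : (0 : ℝ) < e := by exact_mod_cast hg.pos
  have hs : (Real.sqrt e : ℂ) ≠ 0 := by exact_mod_cast hg.sqrt_ne_zero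
  have hs2 : (Real.sqrt e : ℂ) ^ 2 = e := by
    rw [← Complex.ofReal_pow, Real.sq_sqrt he.le, Complex.ofReal_natCast]
  rw [denom, hg.coe_eq]
  simp only [smul_of, smul_cons, smul_eq_mul, smul_empty, of_apply, cons_val', cons_val_zero,
    cons_val_one]
  push_cast
  field_simp
  rw [hs2]

theorem IsAtkinLehner.coe_smul_eq {e M : ℕ} {a b c d : ℤ} {g : GL (Fin 2) ℝ}
    (hg : IsAtkinLehner e M a b c d g) (τ : ℍ) :
    ((g • τ : ℍ) : ℂ) = (e * a * τ + b) / (e * (M * c * τ + d)) := by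
  have hs : (Real.sqrt e : ℂ) ≠ 0 := by exact_mod_cast hg.sqrt_ne_zero
  rw [coe_smul_of_det_pos (by rw [hg.det_eq]; exact one_pos), num, denom, hg.coe_eq]
  simp only [smul_of, smul_cons, smul_eq_mul, smul_empty, of_apply, cons_val', cons_val_zero,
    cons_val_one]
  push_cast
  rw [← mul_div_mul_left (_ + _) _ hs]
  congr 1 <;> field_simp

/-- Multiplying by `gh` turns the Atkin–Lehner matrix into the integral unimodular matrix `(ga, hb;
(M/h)c, (e/g)d)` acting on `(e/g)hτ`. Its lower left entry is odd, so the eta law applies, and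
`√(e/g)` splits off from the automorphy factor. -/
theorem eta_natCast_mul_atkinLehner {e M : ℕ} {a b : ℤ} {c : ℕ} {d : ℤ} {γ : GL (Fin 2) ℝ}
    (hγ : IsAtkinLehner e M a b c d γ) (hM : Odd M) (hc : Odd c) (τ : ℍ) {g h : ℕ}
    (hg : g ∈ e.divisors) (hh : h ∈ M.divisors) :
    η (((g * h : ℕ) : ℂ) * ((γ • τ : ℍ) : ℂ)) = jacobiSym ((e / g : ℕ) * d) (M / h * c) *
      ζ₂₄ ^ etaExponent (g * a) (h * b) ((M / h : ℕ) * c) ((e / g : ℕ) * d) *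
      Real.sqrt (e / g : ℕ) * ((M * c * τ + d : ℂ) / Complex.I).sqrt *
      η (((e / g * h : ℕ) : ℂ) * (τ : ℂ)) := by
  obtain ⟨G, rfl⟩ := Nat.dvd_of_mem_divisors hg
  obtain ⟨H, rfl⟩ := Nat.dvd_of_mem_divisors hh
  have hg0 : 0 < g := Nat.pos_of_mul_pos_right hγ.pos
  have hG0 : 0 < G := Nat.pos_of_mul_pos_left hγ.pos
  have hh0 : 0 < h := Nat.pos_of_mem_divisors hh
  have hH0 : 0 < H := Nat.pos_of_mul_pos_left hM.pos
  rw [Nat.mul_div_cancel_left _ hg0, Nat.mul_div_cancel_left _ hh0]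
  have hH : Odd H := (Nat.odd_mul.1 hM).2
  have hlaw := etaLaw_of_odd (H * c) (hH.mul hc) (g * a) (h * b) (G * d)
    (by have := hγ.det; push_cast at this ⊢; linear_combination this) _
    (im_natCast_mul_pos (Nat.mul_pos hG0 hh0) τ)
  have hre : 0 < ((((h * H : ℕ) : ℂ) * c * τ + d) / Complex.I : ℂ).re := by
    rw [Complex.div_I_re]
    have := im_natCast_mul_pos (Nat.mul_pos (Nat.mul_pos hh0 hH0) hc.pos) τ
    push_cast at this ⊢
    simpa using this
  have hw0 : ((h : ℂ) * H * c * τ + d) ≠ 0 := fun h0 => by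
    push_cast at hre
    rw [h0] at hre
    simp at hre
  rw [hγ.coe_smul_eq]
  have harg : (((g * h : ℕ) : ℂ) * ((((g * G : ℕ) : ℂ) * a * τ + b) /
        ((g * G : ℕ) * (((h * H : ℕ) : ℂ) * (c : ℤ) * τ + d)))) =
      (((g * a : ℤ) : ℂ) * (((G * h : ℕ) : ℂ) * (τ : ℂ)) + (h * b : ℤ)) /
        ((H * c : ℕ) * (((G * h : ℕ) : ℂ) * (τ : ℂ)) + (G * d : ℤ)) := by
    have hg1 : (g : ℂ) ≠ 0 := by exact_mod_cast hg0.ne'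
    have hG1 : (G : ℂ) ≠ 0 := by exact_mod_cast hG0.ne'
    push_cast
    rw [show (H : ℂ) * c * (G * h * τ) + G * d = G * (h * H * c * τ + d) by ring]
    field_simp
  have hsq : ((((H * c : ℕ) : ℂ) * (((G * h : ℕ) : ℂ) * (τ : ℂ)) + (G * d : ℤ)) / Complex.I).sqrt =
      Real.sqrt G * ((((h * H : ℕ) : ℂ) * c * τ + d) / Complex.I).sqrt := by
    rw [← Complex.sqrt_natCast_mul hG0 hre]
    congr 1
    push_cast
    ring
  rw [harg, hlaw, hsq]
  push_cast
  ring

theorem Finset.prod_const_prod_const {α β R : Type*} [CommMonoid R] (s : Finset α) (t : Finset β)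
    (x : R) : ∏ _i ∈ s, ∏ _j ∈ t, x = x ^ (s.card * t.card) := by
  rw [Finset.prod_const, Finset.prod_const, ← pow_mul, mul_comm]

theorem etaProd_slash_atkinLehner {N l K : ℕ} (hN : Squarefree N)
    (hσ : 24 ∣ l * ArithmeticFunction.sigma 1 N) (hl : 2 ^ N.primeFactors.card * l = 2 * K)
    (hK : 4 ∣ K) {e M : ℕ} {a b : ℤ} {c : ℕ} {d : ℤ} {γ : GL (Fin 2) ℝ} (heM : e * M = N)
    (hM : Odd M) (hc : Odd c) (hγ : IsAtkinLehner e M a b c d γ) :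
    etaProd N l ∣[(K : ℤ)] γ = etaProd N l := by
  subst heM
  obtain ⟨hcp, he, hMs⟩ := Nat.squarefree_mul_iff.1 hN
  have hω : (e * M).primeFactors.card = e.primeFactors.card + M.primeFactors.card := by
    rw [Nat.Coprime.primeFactors_mul hcp, Finset.card_union_of_disjoint hcp.disjoint_primeFactors]
  have hcard : e.divisors.card * M.divisors.card * l = 2 * K := by
    rw [he.card_divisors_eq, hMs.card_divisors_eq, ← pow_add, ← hω, hl]
  ext τ
  rw [slash_apply_of_det_eq_one hγ.det_eq, _root_.zpow_neg, zpow_natCast]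
  have hden : denom γ τ ^ K ≠ 0 := pow_ne_zero _ (denom_ne_zero γ τ)
  rw [mul_inv_eq_iff_eq_mul₀ hden, hγ.denom_eq]
  simp only [etaProd, Finset.prod_pow]
  -- The map `gh ↦ (e/g)h` permutes the divisors of `eM`, so the eta factors reappear and only the
  -- multipliers remain.
  have hprod : ∏ v ∈ (e * M).divisors, η ((v : ℂ) * ((γ • τ : ℍ) : ℂ)) =
      ((∏ g ∈ e.divisors, ∏ h ∈ M.divisors, jacobiSym ((e / g : ℕ) * d) (M / h * c) : ℤ) : ℂ) *
      ζ₂₄ ^ (∑ g ∈ e.divisors, ∑ h ∈ M.divisors,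
        etaExponent (g * a) (h * b) ((M / h : ℕ) * c) ((e / g : ℕ) * d)) *
      ((∏ g ∈ e.divisors, Real.sqrt g) ^ M.divisors.card : ℝ) *
      ((M * c * τ + d : ℂ) / Complex.I).sqrt ^ (e.divisors.card * M.divisors.card) *
      ∏ v ∈ (e * M).divisors, η (v * τ) := by
    rw [hcp.prod_divisors_mul_eq, hcp.prod_divisors_mul_eq,
      Finset.prod_congr rfl fun g hg => Finset.prod_congr rfl fun h hh =>
        eta_natCast_mul_atkinLehner hγ hM hc τ hg hh]
    simp only [Finset.prod_mul_distrib, Finset.prod_const_prod_const]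
    congr 1
    · congr 1
      congr 1
      · congr 1
        · push_cast; rfl
        · have hz : ∀ (s : Finset ℕ) (f : ℕ → ℤ), ∏ i ∈ s, ζ₂₄ ^ f i = ζ₂₄ ^ ∑ i ∈ s, f i := by
            intro s f
            induction s using Finset.induction_on with
            | empty => simp
            | insert i s hi ih =>
              rw [Finset.prod_insert hi, Finset.sum_insert hi, ih,
                zpow_add₀ zetaTwentyFour_ne_zero]
          simp only [hz]
      · push_cast
        simp only [Finset.prod_const, Finset.prod_pow]
        rw [Nat.prod_div_divisors e (fun g => (Real.sqrt g : ℂ))]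
    · exact Nat.prod_div_divisors e (fun g => ∏ h ∈ M.divisors, η (((g * h : ℕ) : ℂ) * (τ : ℂ)))
  have hJ : ((∏ g ∈ e.divisors, ∏ h ∈ M.divisors,
      jacobiSym ((e / g : ℕ) * d) (M / h * c) : ℤ) : ℂ) ^ l = 1 := by
    rw [Nat.prod_div_divisors e (fun g => ∏ h ∈ M.divisors, jacobiSym ((g : ℕ) * d) (M / h * c)),
      Finset.prod_congr rfl fun g hg =>
        Nat.prod_div_divisors M (fun h => jacobiSym ((g : ℕ) * d) (h * c))]
    have hcop : IsCoprime ((e : ℤ) * d) ((M : ℤ) * c) :=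
      ⟨a, -b, by linear_combination hγ.det⟩
    -- For even `l` each symbol, being `±1`, disappears. For odd `l` the condition `8 ∣ 2K = 2^ω(N)
    -- l` forces three prime factors.
    rcases Nat.even_or_odd l with ⟨j, hj⟩ | hlo
    · rw [hj, ← two_mul, pow_mul, ← Int.cast_pow, ← Finset.prod_pow]
      rw [Finset.prod_eq_one, Int.cast_one, one_pow]
      intro G hG
      rw [← Finset.prod_pow]
      refine Finset.prod_eq_one fun H hH => jacobiSym.sq_one ?_
      rw [← Int.isCoprime_iff_gcd_eq_one, Nat.cast_mul]
      refine (hcop.of_isCoprime_of_dvd_left ?_).of_isCoprime_of_dvd_right ?_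
      · exact mul_dvd_mul_right (Int.natCast_dvd_natCast.2 (Nat.dvd_of_mem_divisors hG)) _
      · exact mul_dvd_mul_right (Int.natCast_dvd_natCast.2 (Nat.dvd_of_mem_divisors hH)) _
    · have h8 : 2 ^ 3 ∣ 2 ^ (e * M).primeFactors.card * l := by
        rw [hl]; exact Nat.mul_dvd_mul_left 2 hK
      have h3 : 3 ≤ (e * M).primeFactors.card := by
        have hco : Nat.Coprime (2 ^ 3) l := Nat.Coprime.pow_left _ hlo.coprime_two_left
        exact (Nat.pow_dvd_pow_iff_le_right (by norm_num)).1 (hco.dvd_of_dvd_mul_right h8)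
      rw [prod_prod_jacobiSym_eq_one hN h3 hc.pos.ne' hcop]
      simp
  have hZ : (ζ₂₄ ^ (∑ g ∈ e.divisors, ∑ h ∈ M.divisors,
      etaExponent (g * a) (h * b) ((M / h : ℕ) * c) ((e / g : ℕ) * d))) ^ l = 1 := by
    rw [← zpow_natCast, ← _root_.zpow_mul, mul_comm]
    exact zetaTwentyFour_zpow_eq_one (dvd_sum_sum_etaExponent hN hM hσ
      (by rw [hl]; exact Nat.mul_dvd_mul_left 2 hK) a b c d)
  have hY : (((∏ g ∈ e.divisors, Real.sqrt g) ^ M.divisors.card : ℝ)) ^ l = Real.sqrt e ^ K := by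
    have hp : 0 ≤ ∏ g ∈ e.divisors, Real.sqrt g := Finset.prod_nonneg fun _ _ => Real.sqrt_nonneg _
    -- Fourth powers remove both the square roots and the half in `∏ g = e^(number of divisors /
    -- 2)`.
    refine (pow_left_inj₀ (n := 4) (by positivity) (by positivity) (by norm_num)).1 ?_
    have h1 : (∏ g ∈ e.divisors, Real.sqrt g) ^ 4 = (e : ℝ) ^ e.divisors.card := by
      rw [show 4 = 2 * 2 by norm_num, pow_mul, ← Finset.prod_pow,
        Finset.prod_congr rfl fun g _ => Real.sq_sqrt (Nat.cast_nonneg g)]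
      have := congrArg (Nat.cast : ℕ → ℝ) e.prod_divisors_sq_eq
      push_cast at this
      exact this
    calc (((∏ g ∈ e.divisors, Real.sqrt g) ^ M.divisors.card) ^ l) ^ 4
        = ((∏ g ∈ e.divisors, Real.sqrt g) ^ 4) ^ (M.divisors.card * l) := by ring
      _ = (e : ℝ) ^ (2 * K) := by rw [h1, ← pow_mul, ← mul_assoc, hcard]
      _ = (Real.sqrt e ^ 2) ^ (2 * K) := by rw [Real.sq_sqrt (Nat.cast_nonneg e)]
      _ = (Real.sqrt e ^ K) ^ 4 := by ring
  have hS : (((M * c * τ + d : ℂ) / Complex.I).sqrt ^ (e.divisors.card * M.divisors.card)) ^ l =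
      ((M : ℂ) * c * τ + d) ^ K := by
    have hI : Complex.I ^ K = 1 := by
      obtain ⟨j, rfl⟩ := hK
      rw [pow_mul, Complex.I_pow_four, one_pow]
    rw [← pow_mul, hcard, pow_mul, Complex.sqrt_sq_eq, div_pow, hI, div_one]
  rw [hprod]
  simp only [mul_pow, hJ, hZ, hS]
  rw [← Complex.ofReal_pow, hY, Complex.ofReal_pow, Int.cast_natCast]
  ring

/-- The Euler product `∏ (1 - q ^ n)`. -/
noncomputable def eulerProd (q : ℂ) : ℂ := ∏' n : ℕ, (1 - q ^ (n + 1))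

theorem differentiableOn_eulerProd : DifferentiableOn ℂ eulerProd (Metric.ball 0 1) :=
  differentiableOn_tprod_one_sub_pow

theorem eulerProd_zero : eulerProd 0 = 1 := by simp [eulerProd]

/-- The product `∏_{v ∣ N} ∏ (1 - q ^ {vn})`. -/
noncomputable def eulerProdLevel (N : ℕ) (q : ℂ) : ℂ := ∏ v ∈ N.divisors, eulerProd (q ^ v)

theorem norm_pow_lt_one {q : ℂ} (hq : ‖q‖ < 1) {v : ℕ} (hv : 0 < v) : ‖q ^ v‖ < 1 := by
  rw [norm_pow]
  exact pow_lt_one₀ (norm_nonneg _) hq hv.ne'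

theorem differentiableOn_eulerProdLevel (N : ℕ) :
    DifferentiableOn ℂ (eulerProdLevel N) (Metric.ball 0 1) := by
  have : eulerProdLevel N = fun q => ∏ v ∈ N.divisors, eulerProd (q ^ v) := rfl
  rw [this]
  refine DifferentiableOn.fun_finsetProd fun v hv => ?_
  refine differentiableOn_eulerProd.comp (by fun_prop) fun q hq => ?_
  rw [mem_ball_zero_iff] at hq ⊢
  exact norm_pow_lt_one hq (Nat.pos_of_mem_divisors hv)

theorem eulerProdLevel_zero (N : ℕ) : eulerProdLevel N 0 = 1 :=
  Finset.prod_eq_one fun v hv => by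
    rw [zero_pow (Nat.pos_of_mem_divisors hv).ne', eulerProd_zero]

theorem etaProd_eq_qParam {N l s : ℕ} (hs : 24 * s = l * ArithmeticFunction.sigma 1 N) (τ : ℍ) :
    etaProd N l τ = 𝕢 1 τ ^ s * eulerProdLevel N (𝕢 1 τ) ^ l := by
  have h1 : ∀ v : ℕ, η (v * τ) = Complex.exp (2 * Real.pi * Complex.I * τ / 24 * v) *
      eulerProd (𝕢 1 τ ^ v) := by
    intro v
    rw [eta, eulerProd, Function.Periodic.qParam]
    congr 1
    · congr 1
      push_cast
      ring
    · have : 𝕢 1 (v * τ) = 𝕢 1 τ ^ v := by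
        rw [Function.Periodic.qParam, Function.Periodic.qParam, ← Complex.exp_nat_mul]
        congr 1
        ring
      simp only [eta_q, this]
  simp only [etaProd, eulerProdLevel, h1, mul_pow, Finset.prod_mul_distrib, Finset.prod_pow]
  congr 1
  rw [← Complex.exp_sum, ← Finset.mul_sum, ← Complex.exp_nat_mul, Function.Periodic.qParam,
    ← Complex.exp_nat_mul]
  congr 1
  have h2 : (24 : ℂ) * s = l * ∑ v ∈ N.divisors, (v : ℂ) := by
    rw [ArithmeticFunction.sigma_one_apply] at hs
    have := congrArg (Nat.cast : ℕ → ℂ) hs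
    push_cast at this
    exact this
  push_cast
  linear_combination (-(2 * Real.pi * Complex.I * τ) / 24) * h2

theorem etaProd_ne_zero (N l : ℕ) (τ : ℍ) : etaProd N l τ ≠ 0 :=
  Finset.prod_ne_zero_iff.2 fun _ hv =>
    pow_ne_zero _ (eta_ne_zero (im_natCast_mul_pos (Nat.pos_of_mem_divisors hv) τ))

theorem tendsto_eulerProdLevel_atImInfty (N : ℕ) :
    Filter.Tendsto (fun τ : ℍ => eulerProdLevel N (𝕢 1 τ)) atImInfty (nhds 1) := by
  have h1 : ContinuousAt (eulerProdLevel N) 0 :=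
    ((differentiableOn_eulerProdLevel N).differentiableAt
      (Metric.ball_mem_nhds 0 one_pos)).continuousAt
  have h2 := h1.tendsto.comp (qParam_tendsto_atImInfty one_pos)
  rwa [eulerProdLevel_zero] at h2

/-- The eta product `∏_{v ∣ N} η(vτ)^l` as a cusp form for `Γ₀(N)⁺`. -/
noncomputable def etaProdCuspForm {N l K s : ℕ} (hN : Squarefree N)
    (hl : 2 ^ N.primeFactors.card * l = 2 * K) (hK : 4 ∣ K)
    (hs : 24 * s = l * ArithmeticFunction.sigma 1 N) (hs0 : s ≠ 0) :
    CuspForm (moonshineLevel N) (K : ℤ) where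
  toFun := etaProd N l
  slash_action_eq' g hg := slash_eq_self_of_mem_moonshineLevel
    (by exact_mod_cast (even_iff_two_dvd.2 (dvd_trans (by norm_num) hK) : Even K)) hN
    (fun _ _ _ _ _ _ _ heM hM hc hg => etaProd_slash_atkinLehner hN ⟨s, hs.symm⟩ hl hK heM hM hc hg)
    hg
  holo' := by
    rw [UpperHalfPlane.mdifferentiable_iff]
    have h1 : DifferentiableOn ℂ (fun z => ∏ v ∈ N.divisors, η (v * z) ^ l) upperHalfPlaneSet := by
      refine DifferentiableOn.fun_finsetProd fun v hv => DifferentiableOn.fun_pow ?_ _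
      intro z hz
      have := (differentiableAt_eta_of_mem_upperHalfPlaneSet
        (im_natCast_mul_pos (Nat.pos_of_mem_divisors hv) ⟨z, hz⟩)).comp z
        (f := fun z => (v : ℂ) * z) (by fun_prop)
      exact this.differentiableWithinAt
    refine h1.congr fun z hz => ?_
    simp [etaProd, ofComplex_apply_of_im_pos (show 0 < z.im from hz)]
  zero_at_cusps' := by
    intro x hx
    obtain ⟨g, hg, rfl⟩ := exists_smul_infty_of_isCusp hN hx
    rw [OnePoint.isZeroAt_iff rfl]
    change IsZeroAtImInfty (etaProd N l ∣[(K : ℤ)] g)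
    rw [slash_eq_self_of_mem_moonshineLevel
      (by exact_mod_cast (even_iff_two_dvd.2 (dvd_trans (by norm_num) hK) : Even K)) hN
      (fun _ _ _ _ _ _ _ heM hM hc hg =>
        etaProd_slash_atkinLehner hN ⟨s, hs.symm⟩ hl hK heM hM hc hg) hg]
    have h1 := ((qParam_tendsto_atImInfty one_pos).pow s).mul
      ((tendsto_eulerProdLevel_atImInfty N).pow l)
    rw [zero_pow hs0, zero_mul] at h1
    exact h1.congr fun τ => (etaProd_eq_qParam hs τ).symm

end

/-! ### Power series of the Euler products -/

section

open PowerSeries Filter Topology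

/-- The power series `P` converges to `F` on the open unit disc. -/
def PowerSeries.Represents (P : ℂ⟦X⟧) (F : ℂ → ℂ) : Prop :=
  ∀ q : ℂ, ‖q‖ < 1 → HasSum (fun m => coeff m P * q ^ m) (F q)

namespace PowerSeries.Represents

theorem mul {P Q : ℂ⟦X⟧} {F G : ℂ → ℂ} (hP : P.Represents F) (hQ : Q.Represents G) :
    (P * Q).Represents fun q => F q * G q := by
  intro q hq
  have h1 := hasSum_sum_range_mul_of_summable_norm (hP q hq).summable.norm (hQ q hq).summable.norm
  rw [(hP q hq).tsum_eq, (hQ q hq).tsum_eq] at h1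
  refine h1.congr_fun fun m => ?_
  rw [coeff_mul, Finset.Nat.sum_antidiagonal_eq_sum_range_succ_mk, Finset.sum_mul]
  refine Finset.sum_congr rfl fun i hi => ?_
  have : i + (m - i) = m := Nat.add_sub_cancel' (Finset.mem_range_succ_iff.1 hi)
  rw [← this, pow_add, this]
  ring

theorem C (c : ℂ) : (PowerSeries.C c).Represents fun _ => c := by
  intro q _
  convert hasSum_single (f := fun m => coeff m (PowerSeries.C c) * q ^ m) 0 ?_ using 1
  · simp
  · intro m hm
    simp [coeff_C, hm]

theorem X : (PowerSeries.X : ℂ⟦X⟧).Represents fun q => q := by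
  intro q _
  convert hasSum_single (f := fun m => coeff m (PowerSeries.X : ℂ⟦X⟧) * q ^ m) 1 ?_ using 1
  · simp
  · intro m hm
    simp [coeff_X, hm]

theorem sub {P Q : ℂ⟦X⟧} {F G : ℂ → ℂ} (hP : P.Represents F) (hQ : Q.Represents G) :
    (P - Q).Represents fun q => F q - G q := by
  intro q hq
  simpa [sub_mul] using (hP q hq).sub (hQ q hq)

theorem one : (1 : ℂ⟦X⟧).Represents fun _ => 1 := by
  simpa using C 1

theorem prod {ι : Type*} (s : Finset ι) {P : ι → ℂ⟦X⟧} {F : ι → ℂ → ℂ}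
    (h : ∀ i ∈ s, (P i).Represents (F i)) :
    (∏ i ∈ s, P i).Represents fun q => ∏ i ∈ s, F i q := by
  induction s using Finset.cons_induction with
  | empty => simpa using one
  | cons i s hi ih =>
    simp only [Finset.prod_cons]
    exact (h i (Finset.mem_cons_self i s)).mul
      (ih fun j hj => h j (Finset.mem_cons_of_mem hj))

theorem pow {P : ℂ⟦X⟧} {F : ℂ → ℂ} (h : P.Represents F) (n : ℕ) :
    (P ^ n).Represents fun q => F q ^ n := by
  simpa using prod (Finset.range n) (P := fun _ => P) (F := fun _ => F) fun _ _ => h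

theorem expand {P : ℂ⟦X⟧} {F : ℂ → ℂ} (h : P.Represents F) {v : ℕ} (hv : v ≠ 0) :
    (PowerSeries.expand v hv P).Represents fun q => F (q ^ v) := by
  intro q hq
  have h1 := h (q ^ v) (norm_pow_lt_one hq (Nat.pos_of_ne_zero hv))
  refine (Function.Injective.hasSum_iff (g := fun m => v * m) (mul_right_injective₀ hv) ?_).1 (h1.congr_fun ?_)
  · intro m hm
    rw [coeff_expand_of_not_dvd, zero_mul]
    rintro ⟨j, rfl⟩
    exact hm ⟨j, rfl⟩
  · intro m
    simp [coeff_expand_mul, pow_mul]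

theorem hasFPowerSeriesOnBall {P : ℂ⟦X⟧} {F : ℂ → ℂ} (h : P.Represents F) :
    HasFPowerSeriesOnBall F (FormalMultilinearSeries.ofScalars ℂ fun m => coeff m P) 0 1 := by
  refine ⟨?_, by simp, ?_⟩
  · refine le_of_forall_lt_imp_le_of_dense fun r hr => ?_
    lift r to NNReal using hr.ne_top
    apply FormalMultilinearSeries.le_radius_of_summable
    simpa [norm_mul] using (h r (by simpa using hr)).summable.norm
  · intro y hy
    rw [← ENNReal.coe_one, Metric.eball_coe, NNReal.coe_one, mem_ball_zero_iff] at hy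
    simpa [mul_comm] using h y hy

theorem coeff_eq {P : ℂ⟦X⟧} {F : ℂ → ℂ} (h : P.Represents F) (m : ℕ) :
    coeff m P = iteratedDeriv m F 0 / m.factorial := by
  have h1 := h.hasFPowerSeriesOnBall.hasFPowerSeriesAt
  have h2 := h1.analyticAt.hasFPowerSeriesAt
  simpa using congr_arg (FormalMultilinearSeries.coeff · m) (h1.eq_formalMultilinearSeries h2)

end PowerSeries.Represents

theorem TendstoLocallyUniformlyOn.iterated_deriv {ι : Type*} {F : ι → ℂ → ℂ} {f : ℂ → ℂ}
    {φ : Filter ι} {U : Set ℂ} (hf : TendstoLocallyUniformlyOn F f φ U)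
    (hF : ∀ᶠ n in φ, DifferentiableOn ℂ (F n) U) (hU : IsOpen U) (m : ℕ) :
    TendstoLocallyUniformlyOn (fun n => iteratedDeriv m (F n)) (iteratedDeriv m f) φ U := by
  suffices TendstoLocallyUniformlyOn (fun n => iteratedDeriv m (F n)) (iteratedDeriv m f) φ U ∧
    ∀ᶠ n in φ, DifferentiableOn ℂ (iteratedDeriv m (F n)) U from this.1
  induction m with
  | zero => simpa using ⟨hf, hF⟩
  | succ m ih =>
    simp only [iteratedDeriv_succ]
    exact ⟨ih.1.deriv ih.2 hU, ih.2.mono fun n h => h.deriv hU⟩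

/-- Euler's pentagonal series is the power series of `∏ (1 - q ^ n)`. -/
theorem represents_eulerProd : (pentagonalSeries ℂ).Represents eulerProd := by
  -- Each coefficient of the partial products is eventually that of the pentagonal series; by
  -- locally uniform convergence it also tends to the Taylor coefficient of the infinite product.
  have hlim : TendstoLocallyUniformlyOn
      (fun (s : Finset ℕ) q => ∏ i ∈ s, (1 - q ^ (i + 1) : ℂ)) eulerProd atTop
      (Metric.ball 0 1) :=
    ModularForm.multipliableLocallyUniformlyOn_one_sub_pow.hasProdLocallyUniformlyOn
  have hrep (s : Finset ℕ) : (∏ i ∈ s, (1 - X ^ (i + 1)) : ℂ⟦X⟧).Represents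
      fun q => ∏ i ∈ s, (1 - q ^ (i + 1) : ℂ) :=
    .prod s fun i _ => .sub .one (.pow .X _)
  have hcoeff (m : ℕ) : coeff m (pentagonalSeries ℂ) =
      (m.factorial : ℂ)⁻¹ * iteratedDeriv m eulerProd 0 := by
    have h1 := (hlim.iterated_deriv (.of_forall fun s => by fun_prop) Metric.isOpen_ball m).tendsto_at
      (Metric.mem_ball_self one_pos)
    have h2 : Tendsto (fun s : Finset ℕ => coeff m (∏ i ∈ s, (1 - X ^ (i + 1)) : ℂ⟦X⟧)) atTop
        (𝓝 ((m.factorial : ℂ)⁻¹ * iteratedDeriv m eulerProd 0)) :=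
      (h1.const_mul _).congr fun s => by rw [(hrep s).coeff_eq, div_eq_inv_mul]
    exact tendsto_nhds_unique (tendsto_nhds_of_eventually_eq
      (coeff_prod_one_sub_X_pow_eventually_eq ℂ m)) h2
  intro q hq
  refine (Complex.hasSum_taylorSeries_on_ball differentiableOn_eulerProd
    (mem_ball_zero_iff.2 hq)).congr_fun fun m => ?_
  rw [hcoeff, sub_zero, smul_eq_mul, smul_eq_mul]
  ring

/-- The power series of `eulerProdLevel N`. -/
noncomputable def eulerSeries (N : ℕ) : ℤ⟦X⟧ :=
  ∏ v ∈ N.divisors.attach,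
    expand v.1 (Nat.pos_of_mem_divisors v.2).ne' (pentagonalSeries ℤ)

theorem map_pentagonalSeries {R S : Type*} [CommRing R] [CommRing S] (f : R →+* S) :
    (pentagonalSeries R).map f = pentagonalSeries S := by
  ext n
  by_cases h : n ∈ Set.range pentagonal
  · obtain ⟨k, rfl⟩ := h
    simp
  · rw [coeff_map, coeff_pentagonalSeries_eq_zero _ h, coeff_pentagonalSeries_eq_zero _ h, map_zero]

theorem represents_eulerProdLevel (N : ℕ) :
    ((eulerSeries N).map (Int.castRingHom ℂ)).Represents (eulerProdLevel N) := by
  rw [eulerSeries, map_prod]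
  have h := PowerSeries.Represents.prod N.divisors.attach (fun v _ =>
    represents_eulerProd.expand (Nat.pos_of_mem_divisors v.2).ne')
  convert h using 1
  · refine Finset.prod_congr rfl fun v _ => ?_
    rw [map_expand, map_pentagonalSeries]
  · ext q
    rw [eulerProdLevel, Finset.prod_attach N.divisors fun v => eulerProd (q ^ v)]

theorem trunc_pentagonal : coeff 0 (pentagonalSeries ℤ) = 1 ∧ coeff 1 (pentagonalSeries ℤ) = -1 := by
  constructor
  · simpa [pentagonal_def] using coeff_pentagonalSeries_pentagonal ℤ 0
  · simpa [pentagonal_def] using coeff_pentagonalSeries_pentagonal ℤ 1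

theorem constantCoeff_eulerSeries (N : ℕ) : constantCoeff (eulerSeries N) = 1 := by
  rw [eulerSeries, map_prod]
  refine Finset.prod_eq_one fun v _ => ?_
  rw [constantCoeff_expand]
  simpa using trunc_pentagonal.1

theorem coeff_one_prod {ι R : Type*} [CommRing R] (s : Finset ι) (P : ι → R⟦X⟧)
    (h : ∀ i ∈ s, constantCoeff (P i) = 1) :
    coeff 1 (∏ i ∈ s, P i) = ∑ i ∈ s, coeff 1 (P i) := by
  induction s using Finset.cons_induction with
  | empty => simp [coeff_one]
  | cons i s hi ih =>
    rw [Finset.prod_cons, Finset.sum_cons, coeff_one_mul,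
      ih fun j hj => h j (Finset.mem_cons_of_mem hj), map_prod,
      Finset.prod_eq_one fun j hj => h j (Finset.mem_cons_of_mem hj),
      h i (Finset.mem_cons_self i s)]
    ring

/-- Only `v = 1` contributes to the coefficient of `q`. The 2-adic argument needs just this:
integral coefficients, constant term 1 and an odd linear term. -/
theorem coeff_one_eulerSeries {N : ℕ} (hN : N ≠ 0) : coeff 1 (eulerSeries N) = -1 := by
  rw [eulerSeries, coeff_one_prod]
  · rw [Finset.sum_eq_single ⟨1, Nat.one_mem_divisors.2 hN⟩]
    · simpa using trunc_pentagonal.2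
    · intro v _ hv
      refine coeff_expand_of_not_dvd _ _ _ fun h => hv (Subtype.ext (Nat.dvd_one.1 h))
    · simp
  · intro v _
    rw [constantCoeff_expand]
    simpa using trunc_pentagonal.1

end

/-! ### 2-adic size of square roots of power series -/

section

open PowerSeries

/-- The `2`-adic absolute value of the `n`-th coefficient of `(1 + X) ^ (1 / 2)`. -/
noncomputable def sqrtCoeffNorm (n : ℕ) : ℚ := 2 ^ n / padicNorm 2 (n.factorial : ℚ)

theorem padicNorm_factorial_pos (n : ℕ) : 0 < padicNorm 2 (n.factorial : ℚ) :=
  lt_of_le_of_ne (padicNorm.nonneg _)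
    (padicNorm.nonzero (Nat.cast_ne_zero.2 n.factorial_ne_zero)).symm

theorem sqrtCoeffNorm_pos (n : ℕ) : 0 < sqrtCoeffNorm n :=
  div_pos (by positivity) (padicNorm_factorial_pos n)

theorem two_mul_sqrtCoeffNorm_le (n : ℕ) : 2 * sqrtCoeffNorm n ≤ sqrtCoeffNorm (n + 1) := by
  have h1 := padicNorm_factorial_pos n
  have h2 : padicNorm 2 ((n + 1).factorial : ℚ) ≤ padicNorm 2 (n.factorial : ℚ) := by
    rw [Nat.factorial_succ, Nat.cast_mul, padicNorm.mul]
    have := padicNorm.of_nat (p := 2) (n + 1)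
    exact mul_le_of_le_one_left h1.le this
  rw [sqrtCoeffNorm, sqrtCoeffNorm, pow_succ', mul_div_assoc']
  exact div_le_div_of_nonneg_left (by positivity) (padicNorm_factorial_pos _) h2

theorem two_pow_mul_sqrtCoeffNorm_le (n m : ℕ) :
    2 ^ m * sqrtCoeffNorm n ≤ sqrtCoeffNorm (n + m) := by
  induction m with
  | zero => simp
  | succ m ih =>
    rw [← add_assoc, pow_succ', mul_assoc]
    exact (mul_le_mul_of_nonneg_left ih (by norm_num)).trans (two_mul_sqrtCoeffNorm_le _)

/-- Each of the `n` factors `1/2 - i` of the numerator is an odd integer over 2, hence of absolute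
value 2. -/
theorem padicNorm_choose_half (n : ℕ) :
    padicNorm 2 (Ring.choose (1 / 2 : ℚ) n) = sqrtCoeffNorm n := by
  have hodd : ∀ i : ℕ, padicNorm 2 (1 / 2 - i : ℚ) = 2 := by
    intro i
    have h1 : (1 / 2 - i : ℚ) = ((1 - 2 * i : ℤ) : ℚ) / 2 := by push_cast; ring
    have h2 : padicNorm 2 ((1 - 2 * i : ℤ) : ℚ) = 1 := by
      rw [padicNorm.int_eq_one_iff]
      omega
    rw [h1, padicNorm.div, h2]
    have := padicNorm.padicNorm_p (p := 2) (by norm_num)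
    push_cast at this
    rw [this]
    norm_num
  have hprod : ∀ n : ℕ, padicNorm 2 (∏ i ∈ Finset.range n, (1 / 2 - i : ℚ)) = 2 ^ n := by
    intro n
    induction n with
    | zero => simp
    | succ n ih => rw [Finset.prod_range_succ, padicNorm.mul, ih, hodd, pow_succ]
  have h := Ring.descPochhammer_eq_factorial_smul_choose (1 / 2 : ℚ) n
  have hsm : (descPochhammer ℤ n).smeval (1 / 2 : ℚ) = ∏ i ∈ Finset.range n, (1 / 2 - i : ℚ) := by
    rw [← descPochhammer_eval_eq_prod_range, ← Polynomial.aeval_eq_smeval, Polynomial.aeval_def,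
      ← Polynomial.eval_map, descPochhammer_map]
  rw [hsm, nsmul_eq_mul] at h
  rw [sqrtCoeffNorm, ← hprod, h, padicNorm.mul, mul_div_cancel_left₀ _ (padicNorm_factorial_pos n).ne']

/-- A power series `W ∈ 1 + X ℤ⟦X⟧` with odd linear coefficient has a square root over `ℚ`, the
coefficients of which have the same `2`-adic absolute values as those of `(1 + X) ^ (1 / 2)`. -/
theorem exists_sq_eq_padicNorm_coeff {W : ℤ⟦X⟧} (h0 : constantCoeff W = 1)
    (h1 : Odd (coeff 1 W)) : ∃ R : ℚ⟦X⟧, R ^ 2 = W.map (Int.castRingHom ℚ) ∧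
      constantCoeff R = 1 ∧ ∀ n, padicNorm 2 (coeff n R) = sqrtCoeffNorm n := by
  -- The root is the binomial series of exponent `1/2` evaluated at `W - 1 = XV`, where `V` has odd
  -- constant term.
  obtain ⟨V, hV⟩ : X ∣ W - 1 := by rw [X_dvd_iff]; simp [h0]
  have hV0 : constantCoeff V = coeff 1 W := by
    have := congrArg (coeff 1) hV
    simpa [coeff_one, coeff_one_X] using this.symm
  set V' : ℚ⟦X⟧ := V.map (Int.castRingHom ℚ)
  have hW : W.map (Int.castRingHom ℚ) = 1 + X * V' := by
    rw [sub_eq_iff_eq_add'.1 hV]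
    simp [V']
  have hs : HasSubst (X * V' : ℚ⟦X⟧) := .of_constantCoeff_zero' (by simp)
  set B := PowerSeries.binomialSeries ℚ (1 / 2 : ℚ)
  have hterm (d n : ℕ) : coeff n ((X * V') ^ d) =
      if d ≤ n then ((coeff (n - d) (V ^ d) : ℤ) : ℚ) else 0 := by
    rw [mul_pow, coeff_X_pow_mul', ← map_pow, coeff_map]
    rfl
  have hcoeff (n : ℕ) : coeff n (B.subst (X * V')) =
      ∑ d ∈ Finset.range (n + 1), Ring.choose (1 / 2 : ℚ) d * (coeff (n - d) (V ^ d) : ℤ) := by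
    rw [coeff_subst' hs, finsum_eq_sum_of_support_subset (s := Finset.range (n + 1))]
    · refine Finset.sum_congr rfl fun d hd => ?_
      rw [hterm, if_pos (Finset.mem_range_succ_iff.1 hd), binomialSeries_coeff]
      simp
    · intro d hd
      by_contra hdn
      refine hd ?_
      simp only
      rw [hterm, if_neg fun h => hdn (by simpa [Nat.lt_succ_iff] using h), smul_zero]
  refine ⟨B.subst (X * V'), ?_, ?_, ?_⟩
  · have hB : B ^ 2 = 1 + X := by
      rw [sq, ← binomialSeries_add]
      have := binomialSeries_nat (R := ℚ) (A := ℚ) 1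
      rw [pow_one] at this
      rw [← this]
      norm_num
    rw [← subst_pow hs, hB, subst_add hs, subst_X hs, hW, ← coe_substAlgHom hs, map_one]
  · rw [← coeff_zero_eq_constantCoeff_apply, hcoeff]
    simp
  · intro n
    -- The term `d = n` is the binomial coefficient times an odd integer. It strictly dominates the
    -- others, since the norms at least double with `d`, so the ultrametric inequality is an
    -- equality.
    rw [hcoeff, Finset.sum_range_succ]
    have hlast : padicNorm 2 (Ring.choose (1 / 2 : ℚ) n * (coeff (n - n) (V ^ n) : ℤ)) =
        sqrtCoeffNorm n := by
      rw [padicNorm.mul, padicNorm_choose_half, Nat.sub_self, coeff_zero_eq_constantCoeff_apply,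
        map_pow, hV0, (padicNorm.int_eq_one_iff _).2, mul_one]
      rw [← Int.not_even_iff_odd, even_iff_two_dvd] at h1
      exact fun h => h1 (Int.prime_two.dvd_of_dvd_pow h)
    rcases Nat.eq_zero_or_pos n with rfl | hn
    · simpa using hlast
    have hrest : padicNorm 2 (∑ d ∈ Finset.range n,
        Ring.choose (1 / 2 : ℚ) d * (coeff (n - d) (V ^ d) : ℤ)) < sqrtCoeffNorm n := by
      refine padicNorm.sum_lt (Finset.nonempty_range_iff.2 hn.ne') fun d hd => ?_
      rw [padicNorm.mul, padicNorm_choose_half]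
      refine (mul_le_of_le_one_right (sqrtCoeffNorm_pos d).le (padicNorm.of_int _)).trans_lt ?_
      obtain ⟨j, rfl⟩ := Nat.exists_eq_add_of_lt (Finset.mem_range.1 hd)
      refine lt_of_lt_of_le ?_ (two_pow_mul_sqrtCoeffNorm_le d (j + 1))
      exact lt_mul_of_one_lt_left (sqrtCoeffNorm_pos d) (one_lt_pow₀ (by norm_num) (by omega))
    rw [padicNorm.add_eq_max_of_ne (by rw [hlast]; exact hrest.ne), hlast, max_eq_right hrest.le]

/-- Two power series over a field of characteristic zero, one of which has constant coefficient
`1`, are proportional as soon as their `K`-th powers are. -/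
theorem PowerSeries.eq_C_mul_of_pow_eq {F : Type*} [Field F] [CharZero F] {A B : F⟦X⟧} {K : ℕ}
    (hK : K ≠ 0) {c : F} (hc : c ≠ 0) (hB : constantCoeff B = 1) (h : A ^ K = C c * B ^ K) :
    ∃ c' : F, c' ≠ 0 ∧ A = C c' * B := by
  have hB0 : constantCoeff B ≠ 0 := by rw [hB]; exact one_ne_zero
  set W := A * B⁻¹
  have hA : A = W * B := by
    rw [mul_assoc, PowerSeries.inv_mul_cancel _ hB0, mul_one]
  have hBK : B ^ K ≠ 0 := pow_ne_zero _ fun h0 => hB0 (by rw [h0, map_zero])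
  have hW : W ^ K = C c := by
    rw [hA, mul_pow] at h
    exact mul_right_cancel₀ hBK h
  have hW0 : W ≠ 0 := fun h0 => by
    rw [h0, zero_pow hK] at hW
    exact hc (by simpa using congrArg constantCoeff hW.symm)
  -- Differentiating `W ^ K = c` gives `K W^(K-1) W' = 0`, so the quotient `W` of `A` by `B` is
  -- constant.
  have hd : derivative F W = 0 := by
    have h1 := congrArg (derivative F) hW
    rw [Derivation.leibniz_pow, derivative_C] at h1
    simp only [smul_eq_mul, nsmul_eq_mul, mul_eq_zero, pow_eq_zero_iff', hW0, false_and,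
      false_or] at h1
    exact h1.resolve_left fun h0 => hK (by simpa using congrArg constantCoeff h0)
  have hWC : W = C (constantCoeff W) := by
    refine derivative.ext (R := F) ?_ (by simp)
    rw [hd, derivative_C]
  refine ⟨constantCoeff W, fun h0 => hW0 (by rw [hWC, h0, map_zero]), ?_⟩
  rw [← hWC, hA]

end

/-! ### The Hecke operator `U_p` for `p` dividing the level -/

section

open Matrix UpperHalfPlane CongruenceSubgroup
open scoped MatrixGroups ModularForm

local notation "𝕢" => Function.Periodic.qParam

/-- The matrix `(1 j; 0 p)`. -/
noncomputable def heckeMatrix (p : ℕ) [NeZero p] (j : ℤ) : GL (Fin 2) ℝ :=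
  GeneralLinearGroup.mkOfDetNeZero !![1, (j : ℝ); 0, (p : ℝ)]
    (by simpa using NeZero.ne p)

section
variable (p : ℕ) [NeZero p] (j : ℤ)

theorem coe_heckeMatrix :
    (heckeMatrix p j : Matrix (Fin 2) (Fin 2) ℝ) = !![1, (j : ℝ); 0, (p : ℝ)] := rfl

theorem det_heckeMatrix : (heckeMatrix p j).det.val = p := by
  rw [Matrix.GeneralLinearGroup.val_det_apply, coe_heckeMatrix, Matrix.det_fin_two_of]
  simp

theorem coe_heckeMatrix_smul (τ : ℍ) : ((heckeMatrix p j • τ : ℍ) : ℂ) = (τ + j) / p := by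
  have hp : (0 : ℝ) < p := by exact_mod_cast Nat.pos_of_ne_zero (NeZero.ne p)
  rw [coe_smul_of_det_pos (by rw [det_heckeMatrix]; exact hp), num, denom, coe_heckeMatrix]
  simp

theorem slash_heckeMatrix_apply (k : ℤ) (f : ℍ → ℂ) (τ : ℍ) :
    (f ∣[k] heckeMatrix p j) τ = (p : ℂ)⁻¹ * f (heckeMatrix p j • τ) := by
  have hp : (0 : ℝ) < p := by exact_mod_cast Nat.pos_of_ne_zero (NeZero.ne p)
  have hp' : (p : ℂ) ≠ 0 := by exact_mod_cast hp.ne'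
  have hσ : σ (heckeMatrix p j) = ContinuousAlgEquiv.refl ℝ ℂ := by
    rw [σ, if_pos (by rw [det_heckeMatrix]; exact hp)]
  have hd : denom (heckeMatrix p j) τ = p := by
    rw [denom, coe_heckeMatrix]
    simp
  rw [ModularForm.slash_apply, det_heckeMatrix, hσ, hd, abs_of_pos hp, zpow_sub_one₀ (by simpa using hp')]
  rw [_root_.zpow_neg]
  have hk : (p : ℂ) ^ k ≠ 0 := zpow_ne_zero _ hp'
  simp only [ContinuousAlgEquiv.refl_apply, Complex.ofReal_natCast]
  field_simp

/-- `heckeMatrix p j` as a matrix over `ℚ`. -/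
theorem exists_map_eq_heckeMatrix :
    ∃ g : GL (Fin 2) ℚ, g.map (Rat.castHom ℝ) = heckeMatrix p j := by
  refine ⟨GeneralLinearGroup.mkOfDetNeZero !![1, (j : ℚ); 0, (p : ℚ)]
    (by simpa using NeZero.ne p), ?_⟩
  ext a b
  fin_cases a <;> fin_cases b <;> simp [heckeMatrix, GeneralLinearGroup.mkOfDetNeZero]

theorem IsCusp.heckeMatrix_smul {c : OnePoint ℝ} (hc : IsCusp c 𝒮ℒ) :
    IsCusp (heckeMatrix p j • c) 𝒮ℒ := by
  obtain ⟨g, hg⟩ := exists_map_eq_heckeMatrix p j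
  have h := hc.smul (heckeMatrix p j)
  rw [← hg] at h ⊢
  have := Subgroup.IsArithmetic.conj 𝒮ℒ g
  exact (Subgroup.IsArithmetic.isCusp_iff_isCusp_SL2Z _).1 h

end

/-- The new upper right entry must be divisible by `p`, that is, `b + jd ≡ a j'` modulo `p`. As `p`
divides the lower left entry, `a` is inverse to `d` modulo `p`, whence the formula for `j'`. -/
theorem exists_mul_eq_mul_heckeMatrix {N p : ℕ} [Fact p.Prime] (hp : p ∣ N) {γ : SL(2, ℤ)}
    (hγ : γ ∈ Gamma0 N) {j j' : ℤ}
    (hj : (j' : ZMod p) = (γ 0 1 + j * γ 1 1) * γ 1 1) :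
    ∃ γ' ∈ Gamma0 N, heckeMatrix p j * SpecialLinearGroup.mapGL ℝ γ =
      SpecialLinearGroup.mapGL ℝ γ' * heckeMatrix p j' := by
  rw [Gamma0_mem, ZMod.intCast_zmod_eq_zero_iff_dvd] at hγ
  obtain ⟨c, hc⟩ := (Int.natCast_dvd_natCast.2 hp).trans hγ
  have hdet : γ 0 0 * γ 1 1 - γ 0 1 * γ 1 0 = 1 := by
    have := γ.det_coe
    rwa [Matrix.det_fin_two] at this
  obtain ⟨B, hB⟩ : (p : ℤ) ∣ γ 0 1 + j * γ 1 1 - (γ 0 0 + j * γ 1 0) * j' := by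
    rw [← ZMod.intCast_zmod_eq_zero_iff_dvd]
    have hd' : ((γ 0 0 : ℤ) : ZMod p) * (γ 1 1 : ℤ) = 1 := by
      have := congrArg (Int.cast : ℤ → ZMod p) hdet
      rw [hc] at this
      push_cast at this
      simpa using this
    push_cast
    rw [hj, hc]
    push_cast
    rw [CharP.cast_eq_zero]
    linear_combination (-((γ 0 1 : ℤ) : ZMod p) - j * (γ 1 1 : ℤ)) * hd'
  obtain ⟨γ', hγ'⟩ : ∃ γ' : SL(2, ℤ), (γ' : Matrix (Fin 2) (Fin 2) ℤ) =
      !![γ 0 0 + j * γ 1 0, B; p * γ 1 0, γ 1 1 - γ 1 0 * j'] := by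
    refine ⟨⟨_, ?_⟩, rfl⟩
    rw [Matrix.det_fin_two_of]
    linear_combination hdet + γ 1 0 * hB
  refine ⟨γ', ?_, ?_⟩
  · rw [Gamma0_mem, ZMod.intCast_zmod_eq_zero_iff_dvd, hγ']
    exact hγ.mul_left _
  · have hB' : (γ 0 1 + j * γ 1 1 - (γ 0 0 + j * γ 1 0) * j' : ℝ) = p * B := by exact_mod_cast hB
    apply Units.ext
    rw [Units.val_mul, Units.val_mul, coe_heckeMatrix, coe_heckeMatrix,
      SpecialLinearGroup.mapGL_coe_matrix, SpecialLinearGroup.mapGL_coe_matrix]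
    ext a b
    fin_cases a <;> fin_cases b <;> simp [Matrix.mul_apply, Fin.sum_univ_two, hγ']
    · linear_combination hB'
    · ring

/-- The Hecke operator `U_p` on modular forms for `Γ₀(N)`, where `p ∣ N`. -/
noncomputable def heckeU {N p : ℕ} [NeZero N] [Fact p.Prime] (hp : p ∣ N) {k : ℤ}
    (f : ModularForm (Gamma0 N : Subgroup (GL (Fin 2) ℝ)) k) :
    ModularForm (Gamma0 N : Subgroup (GL (Fin 2) ℝ)) k where
  toFun := ∑ j : ZMod p, ⇑f ∣[k] heckeMatrix p j.val
  slash_action_eq' := by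
    rintro _ ⟨γ, hγ, rfl⟩
    rw [SlashAction.sum_slash]
    have hdet : ((γ 0 0 : ℤ) : ZMod p) * (γ 1 1 : ℤ) = 1 := by
      have h := γ.det_coe
      rw [Matrix.det_fin_two] at h
      have h1 : ((γ 1 0 : ℤ) : ZMod p) = 0 := by
        rw [SetLike.mem_coe, Gamma0_mem, ZMod.intCast_zmod_eq_zero_iff_dvd] at hγ
        rw [ZMod.intCast_zmod_eq_zero_iff_dvd]
        exact (Int.natCast_dvd_natCast.2 hp).trans hγ
      have := congrArg (Int.cast : ℤ → ZMod p) h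
      push_cast at this
      rw [h1] at this
      simpa using this
    have hd0 : ((γ 1 1 : ℤ) : ZMod p) ≠ 0 := right_ne_zero_of_mul_eq_one hdet
    -- Right multiplication by `γ` permutes the `p` matrices, up to left factors in `Γ₀(N)`, by this
    -- affine bijection.
    let e : ZMod p → ZMod p := fun j => ((γ 0 1 : ℤ) + j * (γ 1 1 : ℤ)) * (γ 1 1 : ℤ)
    have he : Function.Bijective e := by
      refine (Finite.injective_iff_bijective).1 fun x y hxy => ?_
      exact mul_right_cancel₀ hd0 (add_left_cancel (mul_right_cancel₀ hd0 hxy))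
    refine Fintype.sum_bijective e he _ _ fun j => ?_
    obtain ⟨γ', hγ', h⟩ := exists_mul_eq_mul_heckeMatrix hp hγ (j := j.val) (j' := (e j).val)
      (by simp [e])
    rw [← SlashAction.slash_mul, h, SlashAction.slash_mul]
    congr 1
    exact SlashInvariantFormClass.slash_action_eq f _ ⟨γ', hγ', rfl⟩
  holo' := by
    refine MDifferentiable.sum fun j _ => ?_
    exact (ModularFormClass.holo f).slash k _
  bdd_at_cusps' := by
    intro c hc
    have hc' := (Subgroup.IsArithmetic.isCusp_iff_isCusp_SL2Z _).1 hc
    have h : ∀ s : Finset (ZMod p),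
        OnePoint.IsBoundedAt c (∑ j ∈ s, ⇑f ∣[k] heckeMatrix p j.val) k := by
      intro s
      induction s using Finset.cons_induction with
      | empty =>
        intro g _
        simpa [IsBoundedAtImInfty] using Filter.const_boundedAtFilter atImInfty (0 : ℂ)
      | cons j s hj ih =>
        rw [Finset.sum_cons]
        refine OnePoint.IsBoundedAt.add (OnePoint.IsBoundedAt.smul_iff.1 ?_) ih
        exact f.bdd_at_cusps' ((Subgroup.IsArithmetic.isCusp_iff_isCusp_SL2Z _).2
          (hc'.heckeMatrix_smul p j.val))
    exact h _

theorem coeff_heckeU {N p : ℕ} [NeZero N] [Fact p.Prime] (hp : p ∣ N) {k : ℤ}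
    (f : ModularForm (Gamma0 N : Subgroup (GL (Fin 2) ℝ)) k) (n : ℕ) :
    (qExpansion 1 (heckeU hp f)).coeff n = (qExpansion 1 f).coeff (p * n) := by
  have hper : (1 : ℝ) ∈ (Gamma0 N : Subgroup (GL (Fin 2) ℝ)).strictPeriods := by simp
  have hcusp : Fact (IsCusp OnePoint.infty (Gamma0 N : Subgroup (GL (Fin 2) ℝ))) :=
    ⟨Subgroup.isCusp_of_mem_strictPeriods one_pos hper⟩
  have hp0 : (p : ℂ) ≠ 0 := by exact_mod_cast NeZero.ne p
  symm
  refine ModularFormClass.qExpansion_coeff_unique (c := fun n => (qExpansion 1 f).coeff (p * n))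
    one_pos hper (fun τ => ?_) n
  have h1 (j : ZMod p) : HasSum (fun m => (p : ℂ)⁻¹ *
      ((qExpansion 1 f).coeff m * (𝕢 p τ ^ m * ZMod.stdAddChar (j * (m : ZMod p)))))
      ((⇑f ∣[k] heckeMatrix p j.val) τ) := by
    rw [slash_heckeMatrix_apply]
    refine ((ModularForm.hasSum_qExpansion f one_pos hper
      (heckeMatrix p j.val • τ)).mul_left _).congr_fun fun m => ?_
    congr 2
    have : (j * (m : ZMod p) : ZMod p) = ((j.val * m : ℤ) : ZMod p) := by simp
    rw [this, ZMod.stdAddChar_coe, coe_heckeMatrix_smul, Function.Periodic.qParam,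
      Function.Periodic.qParam, ← Complex.exp_nat_mul, ← Complex.exp_nat_mul, ← Complex.exp_add]
    congr 1
    push_cast
    field_simp
  have h2 := hasSum_sum (s := Finset.univ) fun j _ => h1 j
  have h3 : HasSum (fun m => if p ∣ m then (qExpansion 1 f).coeff m * 𝕢 p τ ^ m else 0)
      (heckeU hp f τ) := by
    have : heckeU hp f τ = ∑ j : ZMod p, (⇑f ∣[k] heckeMatrix p j.val) τ := by
      change (∑ j : ZMod p, ⇑f ∣[k] heckeMatrix p j.val) τ = _
      rw [Finset.sum_apply]
    rw [this]
    refine h2.congr_fun fun m => ?_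
    -- Orthogonality of additive characters retains only the exponents divisible by `p`; the
    -- resulting factor `p` cancels the normalisation of the slash action.
    rw [← Finset.mul_sum, ← Finset.mul_sum, ← Finset.mul_sum,
      AddChar.sum_mulShift _ (ZMod.isPrimitive_stdAddChar p), ZMod.card]
    by_cases hm : p ∣ m
    · rw [if_pos hm, if_pos ((ZMod.natCast_eq_zero_iff m p).2 hm)]
      field_simp
    · rw [if_neg hm, if_neg fun h => hm ((ZMod.natCast_eq_zero_iff m p).1 h)]
      simp
  have h4 := (Function.Injective.hasSum_iff (g := fun n => p * n)
    (mul_right_injective₀ (NeZero.ne p)) ?_).2 h3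
  · refine h4.congr_fun fun n => ?_
    simp only [Function.comp_apply, dvd_mul_right, if_true, smul_eq_mul]
    congr 1
    rw [pow_mul]
    congr 1
    rw [Function.Periodic.qParam, Function.Periodic.qParam, ← Complex.exp_nat_mul]
    congr 1
    push_cast
    field_simp
  · intro m hm
    rw [if_neg]
    rintro ⟨n, rfl⟩
    exact hm ⟨n, rfl⟩

end

/-! ### Finite determination, linear recurrences and the 2-adic contradiction -/

section

open UpperHalfPlane CongruenceSubgroup Filter Topology
open scoped MatrixGroups ModularForm Manifold

local notation "𝕢" => Function.Periodic.qParam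

/-- Order of vanishing as a growth condition, a form that can be multiplied over the cosets in a
norm. -/
theorem qExpansion_coeff_eq_zero_iff_isBigO {f : ℍ → ℂ}
    (hper : Function.Periodic (f ∘ ofComplex) (1 : ℝ)) (hhol : MDiff f) (hbdd : IsBoundedAtImInfty f)
    (n : ℕ) : (∀ m < n, (qExpansion 1 f).coeff m = 0) ↔
      f =O[atImInfty] fun τ => (𝕢 1 τ) ^ n := by
  have han := analyticAt_cuspFunction_zero one_pos hper hhol hbdd
  have hq := qParam_tendsto_atImInfty one_pos
  have heq (τ : ℍ) : cuspFunction 1 f (𝕢 1 τ) = f τ := eq_cuspFunction τ one_ne_zero hper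
  have hord : (∀ m < n, (qExpansion 1 f).coeff m = 0) ↔
      (n : ℕ∞) ≤ analyticOrderAt (cuspFunction 1 f) 0 := by
    rw [natCast_le_analyticOrderAt_iff_iteratedDeriv_eq_zero han]
    refine forall₂_congr fun m _ => ?_
    rw [qExpansion_coeff]
    simp [Nat.factorial_ne_zero]
  rw [hord]
  constructor
  · intro h
    obtain ⟨g, hg, hF⟩ := (natCast_le_analyticOrderAt han).1 h
    have h1 := hg.continuousAt.tendsto.comp hq
    have h2 := (h1.isBigO_one ℂ).mul
      (Asymptotics.isBigO_refl (fun τ : ℍ => (𝕢 1 τ) ^ n) atImInfty)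
    refine h2.congr' ?_ (Eventually.of_forall fun τ => one_mul _)
    filter_upwards [hq.eventually hF] with τ hτ
    rw [← heq, hτ, sub_zero, smul_eq_mul, mul_comm]
    rfl
  · intro h
    by_contra hlt
    rw [not_le] at hlt
    obtain ⟨m, hm⟩ := ENat.ne_top_iff_exists.1 hlt.ne_top
    rw [← hm, Nat.cast_lt] at hlt
    obtain ⟨g, hg, hg0, hF⟩ := (han.analyticOrderAt_eq_natCast).1 hm.symm
    have h1 := hg.continuousAt.tendsto.comp hq
    refine hg0 (tendsto_nhds_unique h1 ?_)
    have h2 : (fun τ : ℍ => (𝕢 1 τ) ^ (n - m)) =o[atImInfty] fun _ => (1 : ℂ) := by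
      rw [Asymptotics.isLittleO_one_iff]
      simpa [Nat.sub_ne_zero_of_lt hlt] using hq.pow (n - m)
    rw [← Asymptotics.isLittleO_one_iff ℂ]
    refine Asymptotics.IsBigO.trans_isLittleO ?_ h2
    obtain ⟨C, hC⟩ := h.bound
    refine Asymptotics.IsBigO.of_bound C ?_
    filter_upwards [hC, hq.eventually hF] with τ h3 h4
    have hq0 : 0 < ‖𝕢 1 (τ : ℂ)‖ ^ m := pow_pos (norm_pos_iff.2 (Function.Periodic.qParam_ne_zero _)) _
    rw [← heq, h4, sub_zero, norm_smul, norm_pow, norm_pow, ← Nat.sub_add_cancel hlt.le, pow_add,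
      mul_comm, ← mul_assoc] at h3
    rw [norm_pow]
    exact le_of_mul_le_mul_right h3 hq0

/-- A modular form for an arithmetic group containing the translation by `1` is determined by
finitely many of its Fourier coefficients. -/
theorem exists_sturm_bound (𝒢 : Subgroup (GL (Fin 2) ℝ)) [𝒢.IsArithmetic]
    (h1 : (1 : ℝ) ∈ 𝒢.strictPeriods) (k : ℤ) : ∃ B : ℕ, ∀ f : ModularForm 𝒢 k,
      (∀ m < B, (qExpansion 1 f).coeff m = 0) → f = 0 := by
  classical
  have hcusp : Fact (IsCusp OnePoint.infty 𝒢) := ⟨Subgroup.isCusp_of_mem_strictPeriods one_pos h1⟩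
  -- One more than a twelfth of the weight of the norm of `f` to level one. The trivial coset
  -- contributes a factor `O(q^B)` and the others are bounded, so the norm vanishes by the level one
  -- bound, and `f` with it.
  refine ⟨(k * Nat.card (𝒮ℒ ⧸ 𝒢.subgroupOf 𝒮ℒ)).toNat / 12 + 1, fun f hf => ?_⟩
  have hper := SlashInvariantFormClass.periodic_comp_ofComplex f h1
  have hO := (qExpansion_coeff_eq_zero_iff_isBigO hper (ModularFormClass.holo f)
    (ModularFormClass.bdd_at_infty f) _).1 hf
  suffices ModularForm.norm 𝒮ℒ f = 0 by
    rw [ModularForm.norm_eq_zero_iff] at this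
    exact DFunLike.coe_injective this
  have hS : (1 : ℝ) ∈ (𝒮ℒ).strictPeriods := by simp
  have hcS : Fact (IsCusp OnePoint.infty 𝒮ℒ) := ⟨Subgroup.isCusp_of_mem_strictPeriods one_pos hS⟩
  set F := ModularForm.norm 𝒮ℒ f
  have hperF := SlashInvariantFormClass.periodic_comp_ofComplex F hS
  have hFO : (F : ℍ → ℂ) =O[atImInfty] fun τ =>
      (𝕢 1 τ) ^ ((k * Nat.card (𝒮ℒ ⧸ 𝒢.subgroupOf 𝒮ℒ)).toNat / 12 + 1) := by
    let := Fintype.ofFinite (𝒮ℒ ⧸ 𝒢.subgroupOf 𝒮ℒ)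
    set n := (k * Nat.card (𝒮ℒ ⧸ 𝒢.subgroupOf 𝒮ℒ)).toNat / 12 + 1
    have hprod : (F : ℍ → ℂ) = ∏ q : 𝒮ℒ ⧸ 𝒢.subgroupOf 𝒮ℒ, SlashInvariantForm.quotientFunc f q := by
      simp [F, ModularForm.coe_norm]
    have hbd : ∀ q : 𝒮ℒ ⧸ 𝒢.subgroupOf 𝒮ℒ, SlashInvariantForm.quotientFunc f q =O[atImInfty]
        fun τ => if q = ⟦1⟧ then (𝕢 1 τ) ^ n else 1 := by
      intro q
      split_ifs with hq
      · rw [hq, SlashInvariantForm.quotientFunc_mk]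
        simpa using hO
      · induction q using Quotient.inductionOn with
        | h r =>
          rw [SlashInvariantForm.quotientFunc_mk]
          suffices h : IsBoundedAtImInfty (⇑f ∣[k] r.val⁻¹) from
            h.trans (Asymptotics.isBigO_of_le _ fun _ => by simp)
          rw [← OnePoint.isBoundedAt_iff (c := r.val⁻¹ • OnePoint.infty) rfl]
          refine ModularFormClass.bdd_at_cusps f
            ((Subgroup.IsArithmetic.isCusp_iff_isCusp_SL2Z _).2 ?_)
          exact hcS.out.smul_of_mem (inv_mem r.2)
    rw [hprod]
    have := Asymptotics.IsBigO.finsetProd (s := Finset.univ) fun q _ => hbd q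
    simpa [Finset.prod_fn, Finset.prod_ite_eq] using this
  have h0 := (qExpansion_coeff_eq_zero_iff_isBigO hperF (ModularFormClass.holo F)
    (ModularFormClass.bdd_at_infty F) _).2 hFO
  refine ModularForm.sturm_bound_levelOne ?_
  refine lt_of_lt_of_le ?_ (PowerSeries.nat_le_order _ _ h0)
  exact_mod_cast Nat.lt_succ_self _

theorem qExpansion_sum_smul {𝒢 : Subgroup (GL (Fin 2) ℝ)} [𝒢.IsArithmetic] [𝒢.HasDetOne]
    (h1 : (1 : ℝ) ∈ 𝒢.strictPeriods) {k : ℤ} {ι : Type*} (s : Finset ι) (c : ι → ℂ)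
    (f : ι → ModularForm 𝒢 k) (m : ℕ) : (qExpansion 1 ⇑(∑ i ∈ s, c i • f i)).coeff m =
      ∑ i ∈ s, c i * (qExpansion 1 (f i)).coeff m := by
  have h := map_sum (ModularForm.qExpansionAddHom one_pos h1 k) (fun i => c i • f i) s
  have h' : qExpansion 1 ⇑(∑ i ∈ s, c i • f i) = ∑ i ∈ s, qExpansion 1 ⇑(c i • f i) := h
  rw [h', map_sum]
  refine Finset.sum_congr rfl fun i _ => ?_
  have h2 : qExpansion 1 ⇑(c i • f i) = c i • qExpansion 1 (f i) :=
    ModularForm.qExpansion_smul one_pos h1 (c i) (f i)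
  rw [h2]
  simp

theorem coeff_heckeU_iterate {N p : ℕ} [NeZero N] [Fact p.Prime] (hp : p ∣ N) {k : ℤ}
    (f : ModularForm (Gamma0 N : Subgroup (GL (Fin 2) ℝ)) k) (j n : ℕ) :
    (qExpansion 1 ((heckeU hp)^[j] f)).coeff n = (qExpansion 1 f).coeff (p ^ j * n) := by
  induction j generalizing n with
  | zero => simp
  | succ j ih =>
    rw [Function.iterate_succ_apply', coeff_heckeU, ih, pow_succ, mul_assoc]

/-- The Fourier coefficients of a modular form for `Γ₀(N)` with rational Fourier coefficients
satisfy a linear recurrence along the powers of a prime dividing `N`. -/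
theorem exists_linear_recurrence {N p : ℕ} [NeZero N] [Fact p.Prime] (hp : p ∣ N) {k : ℤ}
    (f : ModularForm (Gamma0 N : Subgroup (GL (Fin 2) ℝ)) k) {a : ℕ → ℚ}
    (ha : ∀ n, (qExpansion 1 f).coeff n = (a n : ℂ)) :
    ∃ (J : ℕ) (c : ℕ → ℚ), ∀ n, a (p ^ J * n) = ∑ j ∈ Finset.range J, c j * a (p ^ j * n) := by
  have h1 : (1 : ℝ) ∈ (Gamma0 N : Subgroup (GL (Fin 2) ℝ)).strictPeriods := by simp
  obtain ⟨B, hB⟩ := exists_sturm_bound (Gamma0 N : Subgroup (GL (Fin 2) ℝ)) h1 k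
  -- These are `B + 1` vectors in `ℚ^B`: the first `B` coefficients of the iterates `U_p^j f`. A
  -- rational relation between them is a relation between the forms, by the choice of `B`.
  have hdep : ¬ LinearIndependent ℚ fun (j : Fin (B + 1)) (m : Fin B) => a (p ^ (j : ℕ) * m) := by
    intro h
    have := h.fintype_card_le_finrank
    simp at this
  obtain ⟨g, hg, j₀, hj₀⟩ := Fintype.not_linearIndependent_iff.1 hdep
  set c : ℕ → ℚ := fun j => if hj : j < B + 1 then g ⟨j, hj⟩ else 0
  have hc : ∀ n, ∑ j ∈ Finset.range (B + 1), c j * a (p ^ j * n) = 0 := by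
    have hzero := hB (∑ j ∈ Finset.range (B + 1), (c j : ℂ) • (heckeU hp)^[j] f) fun m hm => by
      rw [qExpansion_sum_smul h1]
      simp only [coeff_heckeU_iterate, ha]
      have := congrFun hg ⟨m, hm⟩
      rw [Finset.sum_apply] at this
      rw [Finset.sum_range]
      simp only [Pi.smul_apply, smul_eq_mul, Pi.zero_apply] at this
      simp only [c, Fin.is_lt, dif_pos, Fin.eta]
      exact_mod_cast this
    intro n
    have := qExpansion_sum_smul h1 (Finset.range (B + 1)) (fun j => (c j : ℂ))
      (fun j => (heckeU hp)^[j] f) n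
    rw [hzero] at this
    simp only [coeff_heckeU_iterate, ha, FunLike.coe_zero, qExpansion_zero, map_zero] at this
    exact_mod_cast this.symm
  have hne : ∃ j ∈ Finset.range (B + 1), c j ≠ 0 :=
    ⟨j₀, Finset.mem_range.2 j₀.2, by simpa only [c, j₀.2, dif_pos] using hj₀⟩
  -- The relation is solved for its term of highest index `J` with nonzero coefficient.
  set S := (Finset.range (B + 1)).filter fun j => c j ≠ 0
  have hS : S.Nonempty := by
    obtain ⟨j, hj, h⟩ := hne
    exact ⟨j, Finset.mem_filter.2 ⟨hj, h⟩⟩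
  obtain ⟨hJ, hJ0⟩ := Finset.mem_filter.1 (S.max'_mem hS)
  set J := S.max' hS
  refine ⟨J, fun j => -c j / c J, fun n => ?_⟩
  have hsub : ∑ j ∈ Finset.range (J + 1), c j * a (p ^ j * n) = 0 := by
    rw [← hc n]
    refine Finset.sum_subset (Finset.range_subset_range.2 (Finset.mem_range.1 hJ)) fun j hj hj' => ?_
    rcases eq_or_ne (c j) 0 with h0 | h0
    · rw [h0, zero_mul]
    · have := S.le_max' j (Finset.mem_filter.2 ⟨hj, h0⟩)
      exact absurd (Finset.mem_range.2 (Nat.lt_succ_of_le this)) hj'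
  rw [Finset.sum_range_succ] at hsub
  apply mul_left_cancel₀ hJ0
  rw [Finset.mul_sum, eq_neg_of_add_eq_zero_right hsub, ← Finset.sum_neg_distrib]
  refine Finset.sum_congr rfl fun j _ => ?_
  field_simp

/-- A modular form for `Γ₀(N)`, `N > 1`, with rational Fourier coefficients cannot have Fourier
coefficients with the same `2`-adic growth as those of `(1 + X) ^ (1 / 2)`. -/
theorem false_of_padicNorm_eq_sqrtCoeffNorm {N p : ℕ} [NeZero N] [Fact p.Prime] (hp : p ∣ N)
    {k : ℤ} (f : ModularForm (Gamma0 N : Subgroup (GL (Fin 2) ℝ)) k) {n₀ : ℕ} {R : PowerSeries ℚ}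
    (hR : ∀ n, padicNorm 2 (PowerSeries.coeff n R) = sqrtCoeffNorm n)
    (hf : qExpansion 1 f = PowerSeries.X ^ n₀ * R.map (algebraMap ℚ ℂ)) : False := by
  have ha : ∀ n, (qExpansion 1 f).coeff n =
      ((PowerSeries.coeff n (PowerSeries.X ^ n₀ * R) : ℚ) : ℂ) := by
    intro n
    have : PowerSeries.X ^ n₀ * R.map (algebraMap ℚ ℂ) =
        (PowerSeries.X ^ n₀ * R).map (algebraMap ℚ ℂ) := by simp
    rw [hf, this, PowerSeries.coeff_map]
    rfl
  obtain ⟨J, c, hc⟩ := exists_linear_recurrence hp f ha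
  have hnorm : ∀ n, n₀ ≤ n → padicNorm 2 (PowerSeries.coeff n (PowerSeries.X ^ n₀ * R)) =
      sqrtCoeffNorm (n - n₀) := by
    intro n hn
    rw [PowerSeries.coeff_X_pow_mul', if_pos hn, hR]
  obtain ⟨s, hs⟩ : ∃ s : ℕ, ∀ j ∈ Finset.range J, padicNorm 2 (c j) < 2 ^ s := by
    have h2 : ∀ x : ℚ, ∃ s : ℕ, x < 2 ^ s := fun x => pow_unbounded_of_one_lt x one_lt_two
    choose t ht using fun j => h2 (padicNorm 2 (c j))
    refine ⟨∑ j ∈ Finset.range J, t j, fun j hj => (ht j).trans_le ?_⟩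
    exact pow_le_pow_right₀ one_le_two (Finset.single_le_sum (fun _ _ => Nat.zero_le _) hj)
  have hp1 : 1 < p := (Fact.out : p.Prime).one_lt
  -- The recurrence is applied at `n = p^i`. For `j < J` the indices `p^j n` and `p^J n` differ by
  -- at least `p^i > s`, so the left side exceeds in norm every term on the right, even after
  -- multiplication by `c j`; also `p^i > n₀`, so that all indices lie beyond the shift.
  set i := s + n₀
  have hi : i < p ^ i := Nat.lt_pow_self hp1
  have hle (j : ℕ) : p ^ i ≤ p ^ j * p ^ i :=
    Nat.le_mul_of_pos_left _ (Nat.pow_pos (by omega))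
  have hlt := padicNorm.sum_lt' (p := 2) (s := Finset.range J)
    (F := fun j => c j * PowerSeries.coeff (p ^ j * p ^ i) (PowerSeries.X ^ n₀ * R))
    (t := sqrtCoeffNorm (p ^ J * p ^ i - n₀)) (fun j hj => ?_) (sqrtCoeffNorm_pos _)
  · rw [← hc, hnorm _ (by have := hle J; omega)] at hlt
    exact hlt.false
  · have hjJ : p ^ j * p ^ i + p ^ i ≤ p ^ J * p ^ i := by
      calc p ^ j * p ^ i + p ^ i ≤ p ^ j * p ^ i + p ^ j * p ^ i := Nat.add_le_add_left (hle j) _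
        _ = 2 * p ^ j * p ^ i := by ring
        _ ≤ p * p ^ j * p ^ i := Nat.mul_le_mul_right _ (Nat.mul_le_mul_right _ hp1)
        _ = p ^ (j + 1) * p ^ i := by ring
        _ ≤ p ^ J * p ^ i := Nat.mul_le_mul_right _
          (Nat.pow_le_pow_right (by omega) (Finset.mem_range.1 hj))
    rw [padicNorm.mul, hnorm _ (by have := hle j; omega)]
    have h3 := two_pow_mul_sqrtCoeffNorm_le (p ^ j * p ^ i - n₀) (p ^ J * p ^ i - p ^ j * p ^ i)
    rw [show p ^ j * p ^ i - n₀ + (p ^ J * p ^ i - p ^ j * p ^ i) = p ^ J * p ^ i - n₀ by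
      have := hle j; omega] at h3
    refine lt_of_lt_of_le (mul_lt_mul_of_pos_right ((hs j hj).trans_le ?_)
      (sqrtCoeffNorm_pos _)) h3
    exact pow_le_pow_right₀ one_le_two (by omega)

end

/-! ### Nowhere vanishing forms on `Γ₀(N)⁺` -/

section

open UpperHalfPlane CongruenceSubgroup Filter Topology
open scoped MatrixGroups ModularForm Manifold

local notation "𝕢" => Function.Periodic.qParam

theorem one_mem_strictPeriods_moonshineLevel (N : ℕ) :
    (1 : ℝ) ∈ (moonshineLevel N).strictPeriods := by
  have h : (1 : ℝ) ∈ (Gamma0 N : Subgroup (GL (Fin 2) ℝ)).strictPeriods := by simp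
  rw [Subgroup.mem_strictPeriods_iff] at h ⊢
  exact gamma0_le_moonshineLevel N h

theorem det_eq_one_of_mem_moonshineLevel {N : ℕ} {g : GL (Fin 2) ℝ} (hg : g ∈ moonshineLevel N) :
    g.det.val = 1 := by
  obtain ⟨e, M, a, b, c, d, -, h⟩ := mem_moonshineLevel_iff.1 hg
  exact h.det_eq

/-- A nonzero function with a `q`-expansion is asymptotic to a multiple of a power of `q`. -/
theorem exists_tendsto_div_qParam_pow {f : ℍ → ℂ} (hper : Function.Periodic (f ∘ ofComplex) (1 : ℝ))
    (hhol : MDiff f) (hbdd : IsBoundedAtImInfty f) (hf : f ≠ 0) :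
    ∃ (n : ℕ) (c : ℂ), c ≠ 0 ∧ Tendsto (fun τ => f τ / 𝕢 1 τ ^ n) atImInfty (𝓝 c) := by
  have han := analyticAt_cuspFunction_zero one_pos hper hhol hbdd
  have hq := qParam_tendsto_atImInfty one_pos
  have htop : analyticOrderAt (cuspFunction 1 f) 0 ≠ ⊤ := by
    intro h
    rw [analyticOrderAt_eq_top] at h
    refine hf ((qExpansion_eq_zero_iff one_pos hper hhol hbdd).1 ?_)
    ext m
    rw [qExpansion_coeff, Filter.EventuallyEq.iteratedDeriv_eq m h]
    simp
  obtain ⟨n, hn⟩ := ENat.ne_top_iff_exists.1 htop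
  obtain ⟨g, hg, hg0, hF⟩ := (han.analyticOrderAt_eq_natCast).1 hn.symm
  refine ⟨n, g 0, hg0, (hg.continuousAt.tendsto.comp hq).congr' ?_⟩
  filter_upwards [hq.eventually hF] with τ hτ
  rw [eq_cuspFunction τ one_ne_zero hper, sub_zero, smul_eq_mul] at hτ
  rw [hτ, mul_div_cancel_left₀ _ (pow_ne_zero _ (Function.Periodic.qParam_ne_zero _))]
  rfl

/-- A nonvanishing weight `0` function with a limit at the cusp is constant. -/
theorem exists_eq_const_of_tendsto {N : ℕ} (hN : Squarefree N) {φ : ℍ → ℂ} (hhol : MDiff φ)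
    (hinv : ∀ g ∈ moonshineLevel N, ∀ τ, φ (g • τ) = φ τ) {L : ℂ}
    (hL : Tendsto φ atImInfty (𝓝 L)) : ∃ c, ∀ τ, φ τ = c := by
  have : NeZero N := ⟨hN.ne_zero⟩
  have hslash : ∀ g ∈ moonshineLevel N, φ ∣[(0 : ℤ)] g = φ := by
    intro g hg
    ext τ
    rw [slash_apply_of_det_eq_one (det_eq_one_of_mem_moonshineLevel hg), hinv g hg]
    simp
  let Φ : ModularForm (moonshineLevel N) 0 :=
    { toFun := φ
      slash_action_eq' := hslash
      holo' := hhol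
      bdd_at_cusps' := by
        intro x hx
        obtain ⟨g, hg, rfl⟩ := exists_smul_infty_of_isCusp hN hx
        rw [OnePoint.isBoundedAt_iff rfl]
        rw [hslash g hg]
        exact hL.isBigO_one ℝ }
  obtain ⟨c, hc⟩ := ModularForm.eq_const_of_weight_zero Φ
  exact ⟨c, fun τ => congrFun hc τ⟩

/-- Two nowhere vanishing modular forms of the same weight for `Γ₀(N)⁺` are proportional. -/
theorem exists_eq_mul_of_ne_zero {N : ℕ} (hN : Squarefree N) {w : ℤ}
    (F G : ModularForm (moonshineLevel N) w) (hF : ∀ τ, F τ ≠ 0) (hG : ∀ τ, G τ ≠ 0) :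
    ∃ c : ℂ, c ≠ 0 ∧ ∀ τ, F τ = c * G τ := by
  have : NeZero N := ⟨hN.ne_zero⟩
  have h1 := one_mem_strictPeriods_moonshineLevel N
  have hcusp : Fact (IsCusp OnePoint.infty (moonshineLevel N)) :=
    ⟨Subgroup.isCusp_of_mem_strictPeriods one_pos h1⟩
  have key : ∀ (H : ModularForm (moonshineLevel N) w), (∀ τ, H τ ≠ 0) →
      ∃ (n : ℕ) (c : ℂ), c ≠ 0 ∧ Tendsto (fun τ => H τ / 𝕢 1 τ ^ n) atImInfty (𝓝 c) :=
    fun H hH => exists_tendsto_div_qParam_pow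
      (SlashInvariantFormClass.periodic_comp_ofComplex H h1) (ModularFormClass.holo H)
      (ModularFormClass.bdd_at_infty H) fun h => hH I (congrFun h I)
  have hinv : ∀ (H : ModularForm (moonshineLevel N) w), ∀ g ∈ moonshineLevel N, ∀ τ,
      H (g • τ) = H τ * denom g τ ^ w := by
    intro H g hg τ
    have h := congrFun (SlashInvariantFormClass.slash_action_eq H g hg) τ
    rw [slash_apply_of_det_eq_one (det_eq_one_of_mem_moonshineLevel hg)] at h
    rw [← h, mul_assoc, ← zpow_add₀ (denom_ne_zero g τ)]
    simp
  -- The form with the larger order at the cusp is divided by the other, so that the quotient has a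
  -- limit there.
  have main : ∀ (F G : ModularForm (moonshineLevel N) w), (∀ τ, F τ ≠ 0) → (∀ τ, G τ ≠ 0) →
      ∀ (a b : ℕ) (c d : ℂ), b ≤ a → d ≠ 0 →
      Tendsto (fun τ => F τ / 𝕢 1 τ ^ a) atImInfty (𝓝 c) →
      Tendsto (fun τ => G τ / 𝕢 1 τ ^ b) atImInfty (𝓝 d) →
      ∃ c : ℂ, c ≠ 0 ∧ ∀ τ, F τ = c * G τ := by
    intro F G hF hG a b c d hab hd hc hd'
    have hlim := (((qParam_tendsto_atImInfty one_pos).pow (a - b)).mul hc).div hd' hd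
    have hφ : Tendsto (fun τ => F τ / G τ) atImInfty (𝓝 ((0 : ℂ) ^ (a - b) * c / d)) := by
      refine hlim.congr fun τ => ?_
      have hq : 𝕢 1 (τ : ℂ) ≠ 0 := Function.Periodic.qParam_ne_zero _
      have hG' := hG τ
      conv_lhs => rw [← Nat.sub_add_cancel hab]
      simp only [Pi.div_apply, Nat.add_sub_cancel, pow_add]
      field_simp
    have hhol : MDiff fun τ => F τ / G τ := by
      rw [UpperHalfPlane.mdifferentiable_iff]
      have h1 := UpperHalfPlane.mdifferentiable_iff.1 (ModularFormClass.holo F)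
      have h2 := UpperHalfPlane.mdifferentiable_iff.1 (ModularFormClass.holo G)
      exact h1.div h2 fun z _ => hG _
    obtain ⟨c, hc⟩ := exists_eq_const_of_tendsto hN hhol (fun g hg τ => by
      have hd := zpow_ne_zero w (denom_ne_zero g τ)
      have := hG τ
      rw [hinv F g hg, hinv G g hg]
      field_simp) hφ
    refine ⟨c, ?_, fun τ => ?_⟩
    · rw [← hc I]
      exact div_ne_zero (hF I) (hG I)
    · rw [← hc τ, div_mul_cancel₀ _ (hG τ)]
  obtain ⟨a, c, hc0, hc⟩ := key F hF
  obtain ⟨b, d, hd0, hd⟩ := key G hG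
  rcases le_total b a with hab | hab
  · exact main F G hF hG a b c d hab hd0 hc hd
  · obtain ⟨x, hx0, hx⟩ := main G F hG hF b a d c hab hc0 hd hc
    exact ⟨x⁻¹, inv_ne_zero hx0, fun τ => by rw [hx, inv_mul_cancel_left₀ hx0]⟩

/-- The Fricke involution fixes `i/√N` with automorphy factor `i`. A nonzero value there forces
`i^(-k) = 1`. -/
theorem four_dvd_of_ne_zero {N : ℕ} (hN : 0 < N) {k : ℤ} (hk : Even k)
    (f : ModularForm (moonshineLevel N) k) (hf : ∀ τ, f τ ≠ 0) : 4 ∣ k := by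
  obtain ⟨w, hw⟩ := IsAtkinLehner.exists (e := N) 1 (a := 0) (b := -1) (c := 1) (d := 0) hN (by simp)
  have hmem : w ∈ moonshineLevel N := mem_moonshineLevel_iff.2 ⟨N, 1, _, _, _, _, mul_one N, hw⟩
  have hs : (0 : ℝ) < Real.sqrt N := Real.sqrt_pos.2 (by exact_mod_cast hN)
  have hs' : (Real.sqrt N : ℂ) ≠ 0 := by exact_mod_cast hs.ne'
  have hsq : (Real.sqrt N : ℂ) ^ 2 = N := by
    rw [← Complex.ofReal_pow, Real.sq_sqrt (Nat.cast_nonneg N), Complex.ofReal_natCast]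
  let τ : ℍ := ⟨Complex.I / Real.sqrt N, by
    rw [Complex.div_ofReal_im, Complex.I_im]
    exact div_pos one_pos hs⟩
  have hτ : (τ : ℂ) = Complex.I / Real.sqrt N := rfl
  have hfix : w • τ = τ := by
    ext1
    rw [hw.coe_smul_eq, hτ, ← hsq]
    push_cast
    field_simp
    simp
  have hden : denom w τ = Complex.I := by
    rw [hw.denom_eq, hτ]
    push_cast
    field_simp
    simp
  have h := congrFun (SlashInvariantFormClass.slash_action_eq f w hmem) τ
  rw [slash_apply_of_det_eq_one hw.det_eq, hfix, hden] at h
  have hI : Complex.I ^ (-k) = 1 := mul_left_cancel₀ (hf τ) (h.trans (mul_one _).symm)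
  obtain ⟨m, rfl⟩ := hk
  rw [← two_mul, ← mul_neg, _root_.zpow_mul, zpow_ofNat, Complex.I_sq] at hI
  rcases Int.even_or_odd m with ⟨j, rfl⟩ | hm
  · exact ⟨j, by ring⟩
  · rw [hm.neg.neg_one_zpow] at hI
    norm_num at hI

theorem PowerSeries.Represents.eq_of_eq {P Q : PowerSeries ℂ} {F G : ℂ → ℂ} (hP : P.Represents F)
    (hQ : Q.Represents G) (h : ∀ q, ‖q‖ < 1 → q ≠ 0 → F q = G q) : P = Q := by
  have hF := hP.hasFPowerSeriesOnBall.hasFPowerSeriesAt.analyticAt.continuousAt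
  have hG := hQ.hasFPowerSeriesOnBall.hasFPowerSeriesAt.analyticAt.continuousAt
  have hev : F =ᶠ[𝓝 0] G := by
    rw [← ContinuousAt.eventuallyEq_nhds_iff_eventuallyEq_nhdsNE hF hG]
    filter_upwards [self_mem_nhdsWithin, mem_nhdsWithin_of_mem_nhds
      (Metric.ball_mem_nhds (0 : ℂ) one_pos)] with q hq0 hq
    exact h q (mem_ball_zero_iff.1 hq) hq0
  ext m
  rw [hP.coeff_eq, hQ.coeff_eq, hev.iteratedDeriv_eq]

theorem PowerSeries.X_pow_mul_eq_iff {R : Type*} [CommRing R] [IsDomain R] {a b : ℕ}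
    {U V : PowerSeries R} (hU : constantCoeff U ≠ 0) (hV : constantCoeff V ≠ 0)
    (h : X ^ a * U = X ^ b * V) : a = b ∧ U = V := by
  have key : ∀ {a b : ℕ} {U V : PowerSeries R}, constantCoeff U ≠ 0 →
      X ^ a * U = X ^ b * V → b ≤ a := by
    intro a b U V hU h
    by_contra! hlt
    have h1 := congrArg (coeff a) h
    rw [coeff_X_pow_mul', if_pos le_rfl, coeff_X_pow_mul', if_neg (by omega), Nat.sub_self,
      coeff_zero_eq_constantCoeff_apply] at h1
    exact hU h1
  obtain rfl := le_antisymm (key hV h.symm) (key hU h)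
  exact ⟨rfl, mul_left_cancel₀ (pow_ne_zero _ X_ne_zero) h⟩

end

/-! ### The minimal weight -/

section

open UpperHalfPlane CongruenceSubgroup Filter Topology
open scoped MatrixGroups ModularForm Manifold

local notation "𝕢" => Function.Periodic.qParam

/-- Restriction of a modular form to a smaller group. -/
def ModularForm.restrict {𝒢 ℋ : Subgroup (GL (Fin 2) ℝ)} (h : 𝒢 ≤ ℋ) {k : ℤ}
    (f : ModularForm ℋ k) : ModularForm 𝒢 k where
  toFun := f
  slash_action_eq' γ hγ := f.slash_action_eq' γ (h hγ)
  holo' := f.holo'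
  bdd_at_cusps' hc := f.bdd_at_cusps' (hc.mono h)

/-- The halving is exact: for `N = 1` the power of 2 is trivial, but the other factor is 24. -/
theorem two_mul_cuspWeightFactor {N : ℕ} (hN : N ≠ 0) :
    2 * cuspWeightFactor N =
      2 ^ N.primeFactors.card * (24 / Nat.gcd 24 (ArithmeticFunction.sigma 1 N)) := by
  refine Nat.mul_div_cancel' ?_
  rcases Nat.eq_zero_or_pos N.primeFactors.card with h | h
  · rw [Finset.card_eq_zero, Nat.primeFactors_eq_empty] at h
    obtain rfl := h.resolve_left hN
    simp
  · exact (dvd_pow_self 2 h.ne').mul_right _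

theorem sigma_one_pos {N : ℕ} (hN : N ≠ 0) : 0 < ArithmeticFunction.sigma 1 N := by
  rw [ArithmeticFunction.sigma_one_apply]
  exact Finset.sum_pos (fun d hd => Nat.pos_of_mem_divisors hd) ⟨1, Nat.one_mem_divisors.2 hN⟩

theorem div_gcd_dvd_of_dvd_mul {a b x : ℕ} (ha : 0 < a) (h : a ∣ x * b) : a / a.gcd b ∣ x := by
  have hg : 0 < a.gcd b := Nat.gcd_pos_of_pos_left b ha
  refine (Nat.coprime_div_gcd_div_gcd hg).dvd_of_dvd_mul_right (n := b / a.gcd b) ?_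
  rw [← Nat.mul_div_assoc _ (Nat.gcd_dvd_right a b)]
  exact Nat.div_dvd_div (Nat.gcd_dvd_left a b) h

/-- The exponents of the eta product of the minimal weight. -/
theorem exists_eta_exponents {N : ℕ} (hN : N ≠ 0) : ∃ l s : ℕ,
    2 ^ N.primeFactors.card * l = 2 * Nat.lcm 4 (cuspWeightFactor N) ∧
    24 * s = l * ArithmeticFunction.sigma 1 N ∧ s ≠ 0 := by
  set σ := ArithmeticFunction.sigma 1 N
  have hσ : 0 < σ := sigma_one_pos hN
  have hg : 0 < Nat.gcd 24 σ := Nat.gcd_pos_of_pos_left σ (by norm_num)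
  obtain ⟨m, hm⟩ := Nat.dvd_lcm_right 4 (cuspWeightFactor N)
  obtain ⟨u, hu⟩ := Nat.gcd_dvd_left 24 σ
  obtain ⟨v, hv⟩ := Nat.gcd_dvd_right 24 σ
  have hdiv : 24 / Nat.gcd 24 σ = u := Nat.div_eq_of_eq_mul_right hg hu
  have h2 := two_mul_cuspWeightFactor hN
  rw [show ArithmeticFunction.sigma 1 N = σ from rfl, hdiv] at h2
  have hu0 : u ≠ 0 := by rintro rfl; simp at hu
  have hv0 : v ≠ 0 := by rintro rfl; rw [mul_zero] at hv; omega
  have hc0 : cuspWeightFactor N ≠ 0 := by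
    intro h
    rw [h, mul_zero] at h2
    exact mul_ne_zero (pow_ne_zero _ two_ne_zero) hu0 h2.symm
  have hm0 : m ≠ 0 := by
    rintro rfl
    rw [mul_zero] at hm
    exact (Nat.lcm_ne_zero (by norm_num) hc0) hm
  -- Here `24 = (24, σ) u`, `σ = (24, σ) v` and `m` is the lcm divided by the weight factor, so `24
  -- v = u σ`.
  refine ⟨u * m, v * m, ?_, ?_, mul_ne_zero hv0 hm0⟩
  · rw [hm, ← mul_assoc, ← mul_assoc, h2]
  · conv_lhs => rw [hu]
    conv_rhs => rw [hv]
    ring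

theorem lcm_dvd_of_sigma_eq {N : ℕ} (hN : N ≠ 0) {k n : ℕ} (h4 : 4 ∣ k)
    (h2 : 2 ^ N.primeFactors.card ∣ 2 * k)
    (h : 24 * n * 2 ^ N.primeFactors.card = 2 * k * ArithmeticFunction.sigma 1 N) :
    Nat.lcm 4 (cuspWeightFactor N) ∣ k := by
  refine Nat.lcm_dvd h4 ?_
  obtain ⟨x, hx⟩ := h2
  have h1 : 24 * n = x * ArithmeticFunction.sigma 1 N := by
    refine Nat.eq_of_mul_eq_mul_left (Nat.two_pow_pos N.primeFactors.card) ?_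
    rw [hx] at h
    linarith
  obtain ⟨y, rfl⟩ := div_gcd_dvd_of_dvd_mul (by norm_num) ⟨n, h1.symm⟩
  refine ⟨y, Nat.eq_of_mul_eq_mul_left two_pos ?_⟩
  rw [hx, ← mul_assoc, ← mul_assoc, two_mul_cuspWeightFactor hN]

theorem hasCuspForm_lcm {N : ℕ} (hN : Squarefree N) :
    HasCuspFormVanishingOnlyAtCusp N (Nat.lcm 4 (cuspWeightFactor N) : ℕ) := by
  obtain ⟨l, s, hl, hs, hs0⟩ := exists_eta_exponents hN.ne_zero
  exact ⟨etaProdCuspForm hN hl (Nat.dvd_lcm_left _ _) hs hs0, etaProd_ne_zero N l⟩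

/-- A nowhere vanishing cusp form for `Γ₀(N)⁺` has positive weight. -/
theorem weight_pos_of_ne_zero {N : ℕ} (hN : Squarefree N) {k : ℤ} (f : CuspForm (moonshineLevel N) k)
    (hf : ∀ τ, f τ ≠ 0) : 0 < k := by
  have : NeZero N := ⟨hN.ne_zero⟩
  have h1 := one_mem_strictPeriods_moonshineLevel N
  have hcusp : Fact (IsCusp OnePoint.infty (moonshineLevel N)) :=
    ⟨Subgroup.isCusp_of_mem_strictPeriods one_pos h1⟩
  by_contra! hk
  rcases hk.lt_or_eq with hk | rfl
  · have := ModularForm.isZero_of_neg_weight hk (f : ModularForm (moonshineLevel N) k)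
    exact hf I (DFunLike.congr_fun this I)
  · obtain ⟨c, hc⟩ := ModularForm.eq_const_of_weight_zero (f : ModularForm (moonshineLevel N) 0)
    have hz : Tendsto (f : ℍ → ℂ) atImInfty (𝓝 0) := CuspFormClass.zero_at_infty f
    have hc' : (f : ℍ → ℂ) = Function.const ℍ c := hc
    rw [hc'] at hz
    refine hf I ?_
    rw [hc']
    exact tendsto_nhds_unique tendsto_const_nhds hz

/-- The `q`-expansion of a nowhere vanishing modular form for `Γ₀(N)⁺`: a power of it is a power
of the Euler product. -/
theorem exists_qExpansion_pow_eq {N : ℕ} (hN : Squarefree N) {k K l s : ℕ} (hK : 4 ∣ K)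
    (hK0 : K ≠ 0) (hl : 2 ^ N.primeFactors.card * l = 2 * K)
    (hs : 24 * s = l * ArithmeticFunction.sigma 1 N) (hs0 : s ≠ 0)
    (f : ModularForm (moonshineLevel N) (k : ℤ)) (hf : ∀ τ, f τ ≠ 0) :
    ∃ (n : ℕ) (A : PowerSeries ℂ) (c : ℂ), c ≠ 0 ∧
      qExpansion 1 f = PowerSeries.X ^ n * A ∧ n * K = s * k ∧
      A ^ K = PowerSeries.C c * (eulerSeries N).map (Int.castRingHom ℂ) ^ (l * k) := by
  have : NeZero N := ⟨hN.ne_zero⟩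
  have h1 := one_mem_strictPeriods_moonshineLevel N
  have hcusp : Fact (IsCusp OnePoint.infty (moonshineLevel N)) :=
    ⟨Subgroup.isCusp_of_mem_strictPeriods one_pos h1⟩
  have hper := SlashInvariantFormClass.periodic_comp_ofComplex f h1
  set D : ModularForm (moonshineLevel N) (K : ℤ) :=
    ((etaProdCuspForm hN hl hK hs hs0 : CuspForm (moonshineLevel N) (K : ℤ)) :
      ModularForm (moonshineLevel N) (K : ℤ))
  have hD : ∀ τ, D τ = etaProd N l τ := fun _ => rfl
  -- Both `f ^ K` and `D ^ k` have weight `Kk` and no zeros.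
  obtain ⟨c, hc0, hc⟩ := exists_eq_mul_of_ne_zero hN (f.pow K)
    ((D.pow k).mcast (b := K * (k : ℤ)) (by ring))
    (fun τ => by
      rw [ModularForm.coe_pow]
      exact pow_ne_zero _ (hf τ))
    (fun τ => by
      rw [ModularForm.mcast_apply, ModularForm.coe_pow]
      exact pow_ne_zero _ (by rw [hD]; exact etaProd_ne_zero N l τ))
  have hc' : ∀ τ, f τ ^ K = c * (𝕢 1 τ ^ (s * k) * eulerProdLevel N (𝕢 1 τ) ^ (l * k)) := by
    intro τ
    have := hc τ
    rw [ModularForm.mcast_apply, ModularForm.coe_pow, ModularForm.coe_pow, Pi.pow_apply,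
      Pi.pow_apply, hD, etaProd_eq_qParam hs] at this
    rw [this]
    ring
  set E := (eulerSeries N).map (Int.castRingHom ℂ)
  have hrep : (qExpansion 1 f).Represents (cuspFunction 1 f) := fun q hq => by
    simpa using hasSum_qExpansion_of_norm_lt one_pos hper (ModularFormClass.holo f)
      (ModularFormClass.bdd_at_infty f) hq
  have hpow : qExpansion 1 f ^ K = PowerSeries.C c * (PowerSeries.X ^ (s * k) * E ^ (l * k)) := by
    refine (hrep.pow K).eq_of_eq ((PowerSeries.Represents.C c).mul
      ((PowerSeries.Represents.X.pow _).mul ((represents_eulerProdLevel N).pow _)))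
      fun q hq hq0 => ?_
    have him := Function.Periodic.im_invQParam_pos_of_norm_lt_one one_pos hq hq0
    have hqτ : 𝕢 1 ((⟨Function.Periodic.invQParam 1 q, him⟩ : ℍ) : ℂ) = q :=
      Function.Periodic.qParam_right_inv one_ne_zero hq0
    have := hc' ⟨Function.Periodic.invQParam 1 q, him⟩
    rw [← eq_cuspFunction _ one_ne_zero hper, hqτ] at this
    exact this
  have hE : PowerSeries.constantCoeff E = 1 := by
    rw [← PowerSeries.coeff_zero_eq_constantCoeff_apply, PowerSeries.coeff_map,
      PowerSeries.coeff_zero_eq_constantCoeff_apply, constantCoeff_eulerSeries, map_one]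
  have hA0 : qExpansion 1 f ≠ 0 := by
    intro h
    rw [h, zero_pow hK0] at hpow
    have h2 := congrArg (PowerSeries.coeff (s * k)) hpow
    rw [PowerSeries.coeff_C_mul, PowerSeries.coeff_X_pow_mul', if_pos le_rfl, Nat.sub_self,
      PowerSeries.coeff_zero_eq_constantCoeff_apply, map_pow, hE] at h2
    simp at h2
    exact hc0 h2.symm
  set A := (qExpansion 1 f).divXPowOrder
  have hA : qExpansion 1 f = PowerSeries.X ^ (qExpansion 1 f).order.toNat * A :=
    PowerSeries.X_pow_order_mul_divXPowOrder.symm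
  have hAc : PowerSeries.constantCoeff A ≠ 0 :=
    fun h => hA0 (PowerSeries.constantCoeff_divXPowOrder_eq_zero_iff.1 h)
  set n := (qExpansion 1 f).order.toNat
  have h2 : PowerSeries.X ^ (n * K) * A ^ K =
      PowerSeries.X ^ (s * k) * (PowerSeries.C c * E ^ (l * k)) := by
    rw [pow_mul, ← mul_pow, ← hA, hpow]
    ring
  obtain ⟨h3, h4⟩ := PowerSeries.X_pow_mul_eq_iff
    (by rw [map_pow]; exact pow_ne_zero _ hAc)
    (by rw [map_mul, map_pow, hE, one_pow, mul_one, PowerSeries.constantCoeff_C]; exact hc0) h2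
  exact ⟨n, A, c, hc0, hA, h3, h4⟩

/-- The weight of a nowhere vanishing form for `Γ₀(N)⁺` is divisible by `2 ^ (ω N - 1)`. -/
theorem two_pow_dvd_of_pow_eq {N : ℕ} (hN : Squarefree N) {k K l n : ℕ} (hk0 : k ≠ 0) (hK : 4 ∣ K)
    (hK0 : K ≠ 0) (hl : 2 ^ N.primeFactors.card * l = 2 * K)
    (f : ModularForm (moonshineLevel N) (k : ℤ)) {A : PowerSeries ℂ} {c : ℂ} (hc : c ≠ 0)
    (hA : qExpansion 1 f = PowerSeries.X ^ n * A)
    (hAK : A ^ K = PowerSeries.C c * (eulerSeries N).map (Int.castRingHom ℂ) ^ (l * k)) :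
    2 ^ N.primeFactors.card ∣ 2 * k := by
  have : NeZero N := ⟨hN.ne_zero⟩
  by_contra hdvd
  obtain ⟨b, t, ht, hbt⟩ := Nat.exists_eq_two_pow_mul_odd (n := 2 * k) (by omega)
  have hbr : b < N.primeFactors.card := by
    by_contra! h
    exact hdvd (hbt ▸ (pow_dvd_pow 2 h).mul_right t)
  -- With `2k = 2^b t`, `t` odd and `b < r`, the power `m = 2^(r-1-b)` turns the formal exponent
  -- `2k/2^r` of the Euler product into `t/2`. So `f ^ m` involves exactly a square root of `E ^ t`.
  obtain ⟨m', hm'⟩ := Nat.exists_eq_add_of_lt hbr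
  obtain ⟨p, hp⟩ := Finset.card_pos.1 (lt_of_le_of_lt (Nat.zero_le b) hbr)
  have hpp : Fact p.Prime := ⟨Nat.prime_of_mem_primeFactors hp⟩
  set E := eulerSeries N
  set m := 2 ^ m'
  obtain ⟨R, hR2, hR0, hR⟩ := exists_sq_eq_padicNorm_coeff (W := E ^ t)
    (by rw [map_pow, constantCoeff_eulerSeries, one_pow]) (by
      rw [← Fin.prod_const, coeff_one_prod]
      · simp [E, coeff_one_eulerSeries hN.ne_zero, ht]
      · exact fun _ _ => constantCoeff_eulerSeries N)
  set R' : PowerSeries ℂ := R.map (algebraMap ℚ ℂ)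
  have hR2' : R' ^ 2 = E.map (Int.castRingHom ℂ) ^ t := by
    have := congrArg (PowerSeries.map (algebraMap ℚ ℂ)) hR2
    rw [map_pow] at this
    rw [this, map_pow, map_pow, ← RingHom.comp_apply, ← PowerSeries.map_comp]
    congr 2
  obtain ⟨K', hK'⟩ : 2 ∣ K := dvd_trans (by norm_num) hK
  have hexp : l * k * m = t * K' := by
    have h1 : 2 ^ N.primeFactors.card * (l * k * m) * 2 = 2 ^ N.primeFactors.card * (t * K') * 2 := by
      calc 2 ^ N.primeFactors.card * (l * k * m) * 2
          = (2 ^ N.primeFactors.card * l) * (2 * k) * m := by ring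
        _ = 2 ^ (b + m' + 1) * (t * K') * 2 := by rw [hl, hbt, hK']; ring
        _ = _ := by rw [← hm']
    exact Nat.eq_of_mul_eq_mul_left (Nat.two_pow_pos _) (Nat.eq_of_mul_eq_mul_right two_pos h1)
  have hAm : (A ^ m) ^ K = PowerSeries.C (c ^ m) * R' ^ K := by
    rw [← pow_mul, mul_comm m K, pow_mul, hAK, mul_pow, ← map_pow, ← pow_mul, hexp, hK', pow_mul,
      ← hR2', pow_mul]
  obtain ⟨c', hc', hAR⟩ := PowerSeries.eq_C_mul_of_pow_eq hK0 (pow_ne_zero m hc)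
    (by simp [R', ← PowerSeries.coeff_zero_eq_constantCoeff_apply, PowerSeries.coeff_map, hR0]) hAm
  have h1 : (1 : ℝ) ∈ (Gamma0 N : Subgroup (GL (Fin 2) ℝ)).strictPeriods := by simp
  set g := (f.restrict (gamma0_le_moonshineLevel N)).pow m
  have hg : qExpansion 1 g = (PowerSeries.X ^ n * A) ^ m := by
    rw [← hA]
    exact ModularForm.qExpansion_pow one_pos h1 (f.restrict (gamma0_le_moonshineLevel N)) m
  refine false_of_padicNorm_eq_sqrtCoeffNorm (Nat.dvd_of_mem_primeFactors hp) (c'⁻¹ • g)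
    (n₀ := n * m) hR ?_
  have h2 : qExpansion 1 ⇑(c'⁻¹ • g) = c'⁻¹ • qExpansion 1 g :=
    ModularForm.qExpansion_smul one_pos h1 c'⁻¹ g
  rw [h2, hg, mul_pow, ← pow_mul, hAR, PowerSeries.smul_eq_C_mul]
  have : PowerSeries.C c'⁻¹ * PowerSeries.C c' = (1 : PowerSeries ℂ) := by
    rw [← map_mul, inv_mul_cancel₀ hc', map_one]
  linear_combination (PowerSeries.X ^ (n * m) * R') * this

end

theorem proposition3p4 (N : ℕ) (hN : Squarefree N) :
    IsLeast {k : ℤ | Even k ∧ HasCuspFormVanishingOnlyAtCusp N k}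
      ((Nat.lcm 4 (cuspWeightFactor N) : ℕ) : ℤ) := by
  have : NeZero N := ⟨hN.ne_zero⟩
  refine ⟨⟨?_, hasCuspForm_lcm hN⟩, ?_⟩
  · obtain ⟨j, hj⟩ := Nat.dvd_lcm_left 4 (cuspWeightFactor N)
    rw [hj]
    exact ⟨2 * j, by push_cast; ring⟩
  · rintro k ⟨hk, f, hf⟩
    have hk0 := weight_pos_of_ne_zero hN f hf
    lift k to ℕ using hk0.le
    norm_cast at hk0 ⊢
    obtain ⟨l, s, hl, hs, hs0⟩ := exists_eta_exponents hN.ne_zero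
    set K := Nat.lcm 4 (cuspWeightFactor N)
    have hK : 4 ∣ K := Nat.dvd_lcm_left _ _
    have hK0 : K ≠ 0 := by
      rintro h0
      rw [h0, mul_zero] at hl
      have hl0 : l = 0 := by simpa using hl
      rw [hl0, zero_mul] at hs
      omega
    obtain ⟨n, A, c, hc, hA, hnK, hAK⟩ := exists_qExpansion_pow_eq hN hK hK0 hl hs hs0
      (f : ModularForm (moonshineLevel N) (k : ℤ)) hf
    refine Nat.le_of_dvd hk0 (lcm_dvd_of_sigma_eq hN.ne_zero (n := n) ?_ ?_ ?_)
    · exact_mod_cast four_dvd_of_ne_zero (Nat.pos_of_ne_zero hN.ne_zero) hk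
        (f : ModularForm (moonshineLevel N) (k : ℤ)) hf
    · exact two_pow_dvd_of_pow_eq hN hk0.ne' hK hK0 hl _ hc hA hAK
    -- The order relation `24 n 2^r = 2k σ(N)`, obtained from `nK = sk` after multiplication by `K`.
    · refine Nat.eq_of_mul_eq_mul_right (Nat.pos_of_ne_zero hK0) ?_
      calc 24 * n * 2 ^ N.primeFactors.card * K
          = 24 * (n * K) * 2 ^ N.primeFactors.card := by ring
        _ = (24 * s) * k * 2 ^ N.primeFactors.card := by rw [hnK]; ring
        _ = (2 ^ N.primeFactors.card * l) * ArithmeticFunction.sigma 1 N * k := by rw [hs]; ring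
        _ = _ := by rw [hl]; ring
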